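/- Let $X$ be a chain (linearly ordered set) with more than one point which is ultrahomogeneous: for all $n$ and all $x_1<\dots<x_n$, $y_1<\dots<y_n$ in $X$ there is $g\in\mathrm{Aut}(X)$ (the group of order automorphisms) with $g(x_k)=y_k$ for $k=1,\dots,n$. Let $\tau_p$ be the topology of pointwise convergence on $\mathrm{Aut}(X)$, where $X$ carries the order topology $\tau$, and $\tau_\partial$ the permutation topology, i.e. pointwise convergence on $X$ with the discrete topology $\tau_d$. Both are group topologies. An equiuniformity on a $G$-space $X$ is a uniformity that is compatible with the topology, for which every $g\in G$ is uniformly continuous, and such that for each uniform covering $u$ there are a neighbourhood $O$ of the unit and a uniform covering $v$ for which $\{OV : V\in v\}$ refines $u$. The maximal equiuniformities $\mathcal U_X^\partial$ for $(\mathrm{Aut}(X),\tau_\partial)\curvearrowright(X,\tau_d)$ and $\mathcal U_X^p$ for $(\mathrm{Aut}(X),\tau_p)\curvearrowright(X,\tau)$ exist and are totally bounded. Let $\beta_\partial X$ and $\beta_pX$ be the completions of $X$ with respect to them; the groups act continuously on these. As equivariant compactifications, $\beta_pX=m(X,\tau)$, the chain obtained from $X$ by filling each gap (improper ones included) with one point,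 with the order topology; and $\beta_\partial X=m(X,\tau_d)$, which is obtained in the same way from the lexicographic product $X\otimes_\ell\{-1,0,1\}$, where $x\in X$ is identified with $(x,0)$. For a uniformity on $X$, embed $\mathrm{Aut}(X)$ in $X^X$ by $g\mapsto(g(x))_{x\in X}$; let $\mathcal U^\partial$ and $\mathcal U^p$ be the uniformities on $\mathrm{Aut}(X)$ induced by the product uniformities of $\mathcal U_X^\partial$ and $\mathcal U_X^p$. Let $L\wedge R$ be the Roelcke uniformity of a topological group (the greatest lower bound of the left and the right uniformity), and let $R_{\mathcal K}$ be the uniformity on $(\mathrm{Aut}(X),\tau_p)$ whose base consists of the coverings $\{OgH : g\in\mathrm{Aut}(X)\}$, where $O$ is a neighbourhood of the unit and $H$ is the pointwise stabilizer of a finite subset of $X$. Completions are identified by isomorphisms of uniform spaces that are compatible with the canonical maps of $\mathrm{Aut}(X)$. Then: (1.1) For $(\mathrm{Aut}(X),\tau_\partial)$ one has $L\wedge R=\mathcal U^\partial$; the completion with respect to $L\wedge R$ is compact, and this Roelcke compactification is the closure of $\mathrm{Aut}(X)$ in $(\beta_\partial X)^X$. (1.2) For $(\mathrm{Aut}(X),\tau_p)$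 one has $R_{\mathcal K}=\mathcal U^p$; the completion with respect to $R_{\mathcal K}$ is compact, and it is the closure of $\mathrm{Aut}(X)$ in $(\beta_pX)^X$. If moreover $X$ is continuous, i.e. has no proper gaps (for every partition of $X$ into non-empty sets $A<B$, either $A$ has a greatest or $B$ has a least element), then: (2.1) the Roelcke compactification of $(\mathrm{Aut}(X),\tau_\partial)$ is the enveloping Ellis semigroup of the action on $\beta_\partial X$, i.e. the closure of $\mathrm{Aut}(X)$ in $(\beta_\partial X)^{\beta_\partial X}$; (2.2) the completion of $(\mathrm{Aut}(X),\tau_p)$ with respect to $R_{\mathcal K}$ is the enveloping Ellis semigroup of the action on $\beta_pX$, i.e. the closure of $\mathrm{Aut}(X)$ in $(\beta_pX)^{\beta_pX}$. -/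

import Mathlib

open Set Filter Topology Uniformity

noncomputable section

/-! ### Chains and their automorphism groups -/

/-- A chain is ultrahomogeneous if every strictly increasing `n`-tuple of points can be mapped onto
every other strictly increasing `n`-tuple by an automorphism. -/
def IsUltrahomogeneous (X : Type*) [LinearOrder X] : Prop :=
  ∀ (n : ℕ) (x y : Fin n → X), StrictMono x → StrictMono y →
    ∃ g : X ≃o X, ∀ k, g (x k) = y k

/-- A chain is continuous if it has no proper gaps: in every cut `(A, Aᶜ)` with `A` and `Aᶜ`
non-empty, either `A` has a greatest element or `Aᶜ` has a least element. -/
def IsContinuousChain (X : Type*) [LinearOrder X] : Prop :=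
  ∀ A : Set X, IsLowerSet A → A.Nonempty → Aᶜ.Nonempty →
    (∃ a, IsGreatest A a) ∨ (∃ b, IsLeast Aᶜ b)

/-- The topology of pointwise convergence on `G`, for an action of `G` on the space `(X, tX)`:
it is generated by the sets `{g | g • x ∈ O}`, where `x : X` and `O` is open. -/
@[reducible] def pointwiseTopology (G : Type*) {X : Type*} [SMul G X] (tX : TopologicalSpace X) :
    TopologicalSpace G :=
  TopologicalSpace.induced (fun (g : G) (x : X) => g • x)
    (@Pi.topologicalSpace X (fun _ => X) (fun _ => tX))

/-- The group `Aut X` of order automorphisms, with the permutation topology: pointwise convergence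
on the discrete set `X`. The stabilizers of points form a subbase of neighbourhoods of the unit. -/
def AutPerm (X : Type*) [LinearOrder X] : Type _ := X ≃o X

/-- The group `Aut X` of order automorphisms, with the topology of pointwise convergence, where
`X` carries the topology of the linear order. -/
def AutPt (X : Type*) [LinearOrder X] : Type _ := X ≃o X

section Groups
variable (X : Type*) [LinearOrder X]

instance : Group (AutPerm X) := inferInstanceAs (Group (X ≃o X))
instance : Group (AutPt X) := inferInstanceAs (Group (X ≃o X))
instance : MulAction (AutPerm X) X := inferInstanceAs (MulAction (X ≃o X) X)
instance : MulAction (AutPt X) X := inferInstanceAs (MulAction (X ≃o X) X)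
instance : TopologicalSpace (AutPerm X) := pointwiseTopology (AutPerm X) (⊥ : TopologicalSpace X)
instance : TopologicalSpace (AutPt X) := pointwiseTopology (AutPt X) (Preorder.topology X)

variable {X}

theorem AutPerm.eventually_smul_eq (g : AutPerm X) (x : X) : ∀ᶠ h in 𝓝 g, h • x = g • x := by
  let _ : TopologicalSpace X := ⊥
  have _ : DiscreteTopology X := ⟨rfl⟩
  have hc : Continuous fun h : AutPerm X => h • x :=
    (continuous_apply x).comp continuous_induced_dom
  exact hc.continuousAt.eventually ((isOpen_discrete {g • x}).mem_nhds rfl)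

instance : IsTopologicalGroup (AutPerm X) where
  continuous_mul := by
    let _ : TopologicalSpace X := ⊥
    refine continuous_induced_rng.2 (continuous_pi fun x => continuous_iff_continuousAt.2 ?_)
    rintro ⟨g, h⟩
    refine tendsto_nhds_of_eventually_eq ?_
    have h1 := (continuous_snd.tendsto (g, h)).eventually (AutPerm.eventually_smul_eq h x)
    have h2 := (continuous_fst.tendsto (g, h)).eventually (AutPerm.eventually_smul_eq g (h • x))
    filter_upwards [h1, h2] with p hp1 hp2
    simp only [Function.comp_apply, mul_smul]
    rw [hp1, hp2]
  continuous_inv := by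
    let _ : TopologicalSpace X := ⊥
    refine continuous_induced_rng.2 (continuous_pi fun x => continuous_iff_continuousAt.2 ?_)
    intro g
    refine tendsto_nhds_of_eventually_eq ?_
    filter_upwards [AutPerm.eventually_smul_eq g (g⁻¹ • x)] with p hp
    simp only [Function.comp_apply]
    rw [inv_smul_eq_iff, hp, smul_inv_smul]

theorem AutPt.smul_lt_smul_iff (g : AutPt X) {x y : X} : g • x < g • y ↔ x < y :=
  OrderIso.lt_iff_lt (g : X ≃o X)

theorem AutPt.smul_le_smul_iff (g : AutPt X) {x y : X} : g • x ≤ g • y ↔ x ≤ y :=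
  OrderIso.le_iff_le (g : X ≃o X)

theorem AutPt.eventually_gt (g : AutPt X) {x a : X} (ha : a < g • x) :
    ∀ᶠ h in 𝓝 g, a < h • x := by
  let _ : TopologicalSpace X := Preorder.topology X
  have _ : OrderTopology X := ⟨rfl⟩
  have hc : Continuous fun h : AutPt X => h • x :=
    (continuous_apply x).comp continuous_induced_dom
  exact hc.continuousAt.eventually (lt_mem_nhds ha)

theorem AutPt.eventually_lt (g : AutPt X) {x a : X} (ha : g • x < a) :
    ∀ᶠ h in 𝓝 g, h • x < a := by
  let _ : TopologicalSpace X := Preorder.topology X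
  have _ : OrderTopology X := ⟨rfl⟩
  have hc : Continuous fun h : AutPt X => h • x :=
    (continuous_apply x).comp continuous_induced_dom
  exact hc.continuousAt.eventually (gt_mem_nhds ha)

instance : IsTopologicalGroup (AutPt X) where
  continuous_mul := by
    let _ : TopologicalSpace X := Preorder.topology X
    have _ : OrderTopology X := ⟨rfl⟩
    refine continuous_induced_rng.2 (continuous_pi fun x => continuous_iff_continuousAt.2 ?_)
    rintro ⟨g, h⟩
    refine tendsto_order.2 ⟨fun a ha => ?_, fun a ha => ?_⟩ <;>
      simp only [Function.comp_apply, mul_smul, gt_iff_lt] at ha ⊢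
    · by_cases hb : ∃ b, a < b ∧ b < g • h • x
      · obtain ⟨b, hab, hb⟩ := hb
        have hb' : g⁻¹ • b < h • x := by
          rwa [← AutPt.smul_lt_smul_iff g, smul_inv_smul]
        have hab' : a < g • (g⁻¹ • b) := by rwa [smul_inv_smul]
        filter_upwards [(continuous_snd.tendsto (g, h)).eventually (AutPt.eventually_gt h hb'),
          (continuous_fst.tendsto (g, h)).eventually (AutPt.eventually_gt g hab')] with p h1 h2
        exact h2.trans ((AutPt.smul_lt_smul_iff p.1).2 h1)
      · have hc : g⁻¹ • a < h • x := by
          rwa [← AutPt.smul_lt_smul_iff g, smul_inv_smul]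
        filter_upwards [(continuous_snd.tendsto (g, h)).eventually (AutPt.eventually_gt h hc),
          (continuous_fst.tendsto (g, h)).eventually (AutPt.eventually_gt g ha)] with p h1 h2
        refine h2.trans_le ((AutPt.smul_le_smul_iff p.1).2 (not_lt.1 fun h3 => hb ⟨g • p.2 • x, ?_, ?_⟩))
        · rwa [← AutPt.smul_lt_smul_iff g, smul_inv_smul] at h1
        · rwa [AutPt.smul_lt_smul_iff g]
    · by_cases hb : ∃ b, g • h • x < b ∧ b < a
      · obtain ⟨b, hb, hab⟩ := hb
        have hb' : h • x < g⁻¹ • b := by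
          rwa [← AutPt.smul_lt_smul_iff g, smul_inv_smul]
        have hab' : g • (g⁻¹ • b) < a := by rwa [smul_inv_smul]
        filter_upwards [(continuous_snd.tendsto (g, h)).eventually (AutPt.eventually_lt h hb'),
          (continuous_fst.tendsto (g, h)).eventually (AutPt.eventually_lt g hab')] with p h1 h2
        exact ((AutPt.smul_lt_smul_iff p.1).2 h1).trans h2
      · have hc : h • x < g⁻¹ • a := by
          rwa [← AutPt.smul_lt_smul_iff g, smul_inv_smul]
        filter_upwards [(continuous_snd.tendsto (g, h)).eventually (AutPt.eventually_lt h hc),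
          (continuous_fst.tendsto (g, h)).eventually (AutPt.eventually_lt g ha)] with p h1 h2
        refine ((AutPt.smul_le_smul_iff p.1).2 (not_lt.1 fun h3 => hb ⟨g • p.2 • x, ?_, ?_⟩)).trans_lt h2
        · rwa [AutPt.smul_lt_smul_iff g]
        · rwa [← AutPt.smul_lt_smul_iff g, smul_inv_smul] at h1
  continuous_inv := by
    let _ : TopologicalSpace X := Preorder.topology X
    have _ : OrderTopology X := ⟨rfl⟩
    refine continuous_induced_rng.2 (continuous_pi fun x => continuous_iff_continuousAt.2 ?_)
    intro g
    refine tendsto_order.2 ⟨fun a ha => ?_, fun a ha => ?_⟩ <;>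
      simp only [Function.comp_apply, gt_iff_lt] at ha ⊢
    · rw [← AutPt.smul_lt_smul_iff g, smul_inv_smul] at ha
      filter_upwards [AutPt.eventually_lt g ha] with p hp
      rwa [← AutPt.smul_lt_smul_iff p, smul_inv_smul]
    · rw [← AutPt.smul_lt_smul_iff g, smul_inv_smul] at ha
      filter_upwards [AutPt.eventually_gt g ha] with p hp
      rwa [← AutPt.smul_lt_smul_iff p, smul_inv_smul]

end Groups

/-! ### Uniformities on a topological group

In Mathlib's order on `UniformSpace`, `u ≤ v` means that `u` is finer than `v`; so the greatest
lower bound with respect to inclusion of uniformities is the supremum `⊔`, and the largest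
(finest) uniformity of a family is its least element. -/

/-- The Roelcke uniformity `L ∧ R`: the finest uniformity which is coarser than both the left and
the right uniformity. -/
def roelckeUniformity (G : Type*) [Group G] [TopologicalSpace G] [IsTopologicalGroup G] :
    UniformSpace G :=
  IsTopologicalGroup.leftUniformSpace G ⊔ IsTopologicalGroup.rightUniformSpace G

/-- The entourage `⋃ g, (O g H) × (O g H)` of the covering `{O g H | g ∈ G}`, where `H` is the
pointwise stabilizer of the finite set `s`. -/
def stabEntourage {G X : Type*} [Group G] [MulAction G X] (O : Set G) (s : Finset X) :
    Set (G × G) :=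
  {p | ∃ g : G,
    (∃ o ∈ O, ∃ k ∈ fixingSubgroup G (s : Set X), p.1 = o * g * k) ∧
    (∃ o ∈ O, ∃ k ∈ fixingSubgroup G (s : Set X), p.2 = o * g * k)}

theorem stabEntourage_mono {G X : Type*} [Group G] [MulAction G X] {O O' : Set G}
    {s s' : Finset X} (hO : O ⊆ O') (hs : s' ⊆ s) :
    stabEntourage O s ⊆ stabEntourage O' s' := by
  have hk : fixingSubgroup G (s : Set X) ≤ fixingSubgroup G (s' : Set X) :=
    fixingSubgroup_antitone G X (by exact_mod_cast hs)
  rintro p ⟨g, ⟨o, ho, k, hk1, e⟩, ⟨o', ho', k', hk2, e'⟩⟩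
  exact ⟨g, ⟨o, hO ho, k, hk hk1, e⟩, ⟨o', hO ho', k', hk hk2, e'⟩⟩

/-- The uniformity `R_𝒦` on `G` for the family `𝒦` of pointwise stabilizers of finite subsets of
`X`: its base consists of the coverings `{O g H | g ∈ G}`, `O` a neighbourhood of the unit,
`H ∈ 𝒦`. -/
def stabUniformity (G X : Type*) [Group G] [TopologicalSpace G] [IsTopologicalGroup G]
    [MulAction G X] : UniformSpace G :=
  UniformSpace.ofCore <| UniformSpace.Core.mkOfBasis
    { sets := {E | ∃ O ∈ 𝓝 (1 : G), ∃ s : Finset X, E = stabEntourage O s}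
      nonempty := ⟨_, univ, univ_mem, ∅, rfl⟩
      inter_sets := by
        classical
        rintro _ _ ⟨O, hO, s, rfl⟩ ⟨O', hO', s', rfl⟩
        exact ⟨_, ⟨O ∩ O', inter_mem hO hO', s ∪ s', rfl⟩, subset_inter
          (stabEntourage_mono inter_subset_left Finset.subset_union_left)
          (stabEntourage_mono inter_subset_right Finset.subset_union_right)⟩ }
    (by
      rintro _ ⟨O, hO, s, rfl⟩ g
      have h : ∃ o ∈ O, ∃ k ∈ fixingSubgroup G (s : Set X), g = o * g * k :=
        ⟨1, mem_of_mem_nhds hO, 1, one_mem _, by simp⟩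
      exact ⟨g, h, h⟩)
    (by
      rintro _ ⟨O, hO, s, rfl⟩
      exact ⟨_, ⟨O, hO, s, rfl⟩, fun p ⟨g, h1, h2⟩ => ⟨g, h2, h1⟩⟩)
    (by
      rintro _ ⟨O, hO, s, rfl⟩
      have hc : Tendsto (fun q : G × G × G => q.1 * q.2.1⁻¹ * q.2.2) (𝓝 (1, 1, 1)) (𝓝 1) := by
        have : Continuous fun q : G × G × G => q.1 * q.2.1⁻¹ * q.2.2 := by fun_prop
        simpa using this.tendsto (1, 1, 1)
      have hm := hc hO
      rw [mem_map, nhds_prod_eq, nhds_prod_eq] at hm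
      obtain ⟨A, hA, B, hB, hAB⟩ := mem_prod_iff.1 hm
      obtain ⟨B1, hB1, B2, hB2, hB12⟩ := mem_prod_iff.1 hB
      refine ⟨_, ⟨A ∩ B1 ∩ B2 ∩ O, by
        exact inter_mem (inter_mem (inter_mem hA hB1) hB2) hO, s, rfl⟩, ?_⟩
      rintro ⟨f, h⟩ ⟨m, ⟨g, ⟨o1, ho1, k1, hk1, e1⟩, ⟨o2, ho2, k2, hk2, e2⟩⟩,
        ⟨g', ⟨o3, ho3, k3, hk3, e3⟩, ⟨o4, ho4, k4, hk4, e4⟩⟩⟩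
      dsimp only at e1 e2 e3 e4
      refine ⟨g', ⟨o1 * o2⁻¹ * o3, ?_, k3 * k2⁻¹ * k1, ?_, ?_⟩, ⟨o4, ho4.2, k4, hk4, e4⟩⟩
      · exact hAB (show (o1, o2, o3) ∈ A ×ˢ B from
          ⟨ho1.1.1.1, hB12 ⟨ho2.1.1.2, ho3.1.2⟩⟩)
      · exact mul_mem (mul_mem hk3 (inv_mem hk2)) hk1
      · have hg : g = o2⁻¹ * (o3 * g' * k3) * k2⁻¹ := by
          rw [← e3, e2]; group
        show f = _
        rw [e1, hg]; group)

/-! ### Completions -/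

/-- The (Hausdorff) completion of the set `α` endowed with the uniformity `u`. -/
def UComp {α : Type*} (u : UniformSpace α) : Type _ := @UniformSpace.Completion α u

instance {α : Type*} (u : UniformSpace α) : UniformSpace (UComp u) :=
  @UniformSpace.Completion.uniformSpace α u

/-- The canonical map of `α` into its completion. -/
def UComp.of {α : Type*} (u : UniformSpace α) (a : α) : UComp u :=
  @UniformSpace.Completion.coe' α u a

/-- The continuous extension to the completion of a uniformly continuous map `f : α → α`. -/
def UComp.map {α : Type*} (u : UniformSpace α) (f : α → α) : UComp u → UComp u :=
  @UniformSpace.Completion.map α u α u f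

/-- `S`, together with the map `j : α → Y` into it, is the completion of `(α, u)`: there is an
isomorphism of uniform spaces of the completion onto `S` which is compatible with the canonical
maps of `α`. -/
def IsCompletionVia {α Y : Type*} [UniformSpace Y] (u : UniformSpace α) (j : α → Y) (S : Set Y) :
    Prop :=
  ∃ e : UComp u ≃ᵤ S, ∀ a, (e (UComp.of u a) : Y) = j a

/-! ### Equiuniformities and the Ellis construction -/

/-- `u` is an equiuniformity on the `G`-space `(X, tX)`: it is compatible with the topology, every
`g ∈ G` is uniformly continuous, and for every uniform covering `{W[y]}` there are a neighbourhood
`O` of the unit and a uniform covering `{V[x]}` such that `{O V[x]}` refines `{W[y]}`. -/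
structure IsEquiuniformity (G : Type*) {X : Type*} [Group G] [TopologicalSpace G] [MulAction G X]
    (tX : TopologicalSpace X) (u : UniformSpace X) : Prop where
  compatible : u.toTopologicalSpace = tX
  saturated : ∀ g : G, UniformContinuous[u, u] fun x => g • x
  bounded : ∀ W ∈ 𝓤[u], ∃ O ∈ 𝓝 (1 : G), ∃ V ∈ 𝓤[u],
    ∀ x, ∃ y, ∀ g ∈ O, ∀ z, (x, z) ∈ V → (y, g • z) ∈ W

/-- The maximal (finest) equiuniformity on the `G`-space `(X, tX)`. -/
def maxEquiuniformity (G : Type*) {X : Type*} [Group G] [TopologicalSpace G] [MulAction G X]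
    (tX : TopologicalSpace X) : UniformSpace X :=
  sInf {u | IsEquiuniformity G tX u}

section Ellis
variable (G : Type*) {X : Type*} [Group G] [MulAction G X] (u : UniformSpace X)

/-- The uniformity on `G` induced by the map `g ↦ (g x)ₓ` from the product uniformity on `X ^ X`,
where each factor carries the uniformity `u`. -/
def ellisUniformity : UniformSpace G :=
  UniformSpace.comap (fun (g : G) (x : X) => g • x)
    (@Pi.uniformSpace X (fun _ => X) (fun _ => u))

variable {G}

/-- The map `ı : G → (bX) ^ X`, `g ↦ (g x)ₓ`, where `bX` is the completion of `(X, u)`. -/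
def orbitMap (g : G) : X → UComp u := fun x => UComp.of u (g • x)

/-- The map `ȷ : G → (bX) ^ (bX)`, where `bX` is the completion of `(X, u)`, which sends `g` to its
continuous extension to `bX`. -/
def extMap (g : G) : UComp u → UComp u := UComp.map u fun x => g • x

variable (G)

/-- The enveloping Ellis semigroup of the action of `G` on the completion `bX` of `(X, u)`: the
closure of `ȷ(G)` in `(bX) ^ (bX)` with the product topology. -/
def envelopingSemigroup : Set (UComp u → UComp u) := closure (range (extMap (G := G) u))

end Ellis

/-! ### Linearly ordered compactifications -/

/-- For a chain `α`, the set `DedekindCut α` of all cuts is obtained from `α` by filling each gap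
(the improper ones included) with one point. With the order topology, it is the smallest linearly
ordered compactification `m α` of `α`. -/
instance (α : Type*) [LinearOrder α] : TopologicalSpace (DedekindCut α) := Preorder.topology _

instance (α : Type*) [LinearOrder α] : OrderTopology (DedekindCut α) := ⟨rfl⟩

/-- The extension to `m α` of an automorphism of the chain `α`. -/
def cutMap {α : Type*} [LinearOrder α] (f : α ≃o α) : DedekindCut α → DedekindCut α :=
  DedekindCut.factorEmbedding (f.toOrderEmbedding.trans DedekindCut.principalEmbedding)

/-- The chain `X ⊗ {-1, 0, 1}` (lexicographic product); the points `(x, 0)` are isolated in its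
order topology. -/
abbrev Tripled (X : Type*) : Type _ := X ×ₗ SignType

/-- The automorphism `(x, i) ↦ (g x, i)` of `X ⊗ {-1, 0, 1}`. -/
def tripledMap {X : Type*} [LinearOrder X] (g : X ≃o X) : Tripled X ≃o Tripled X :=
  Prod.Lex.prodLexCongr g (OrderIso.refl SignType)

/-! ### The maximal equivariant compactifications of a chain -/

section Beta
variable (X : Type*) [LinearOrder X]

/-- The maximal equiuniformity for the action of `Aut X`, with the permutation topology, on the
discrete space `X`. -/
def permU : UniformSpace X := maxEquiuniformity (AutPerm X) (⊥ : TopologicalSpace X)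

/-- The maximal equiuniformity for the action of `Aut X`, with the topology of pointwise
convergence, on `X` with the topology of the linear order. -/
def ptU : UniformSpace X := maxEquiuniformity (AutPt X) (Preorder.topology X)

/-- `β_∂ X = m (X, τ_d)`, where `m (X, τ_d) = m (X ⊗ {-1, 0, 1})`: the completion of `X` with
respect to the maximal equiuniformity and `m (X, τ_d)` are homeomorphic by an equivariant map which
sends `x` to `(x, 0)`. -/
def PermBetaEqCuts : Prop :=
  ∃ φ : UComp (permU X) ≃ₜ DedekindCut (Tripled X),
    (∀ x, φ (UComp.of (permU X) x) = DedekindCut.principal (toLex (x, 0))) ∧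
    ∀ (g : AutPerm X) z, φ (extMap (permU X) g z) = cutMap (tripledMap (g : X ≃o X)) (φ z)

/-- `β_p X = m (X, τ)`: the completion of `X` with respect to the maximal equiuniformity and
`m (X, τ)` are homeomorphic by an equivariant map which is the identity on `X`. -/
def PtBetaEqCuts : Prop :=
  ∃ φ : UComp (ptU X) ≃ₜ DedekindCut X,
    (∀ x, φ (UComp.of (ptU X) x) = DedekindCut.principal x) ∧
    ∀ (g : AutPt X) z, φ (extMap (ptU X) g z) = cutMap (g : X ≃o X) (φ z)

end Beta

/-- `u` is the maximal equiuniformity of the `G`-space `(X, tX)` and is totally bounded, and `G`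
acts continuously on the completion of `(X, u)`; so this completion is the maximal
`G`-compactification of `X`. -/
structure IsMaxTotallyBounded (G : Type*) {X : Type*} [Group G] [TopologicalSpace G]
    [MulAction G X] (tX : TopologicalSpace X) (u : UniformSpace X) : Prop where
  isLeast : IsLeast {v | IsEquiuniformity G tX v} u
  totallyBounded : @TotallyBounded X u univ
  continuous_action : Continuous fun p : G × UComp u => extMap u p.1 p.2

end

/-!
The uniformities in question all have explicit descriptions in terms of the order.

*The space.* A chain `L` carries the uniformity `orderUniformity L` generated by the coverings
`{Iio b, Ioi a}`, `a < b`. It is compatible with the order topology, and it is induced by the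
embedding of `L` into the compact chain `DedekindCut L`
(`orderUniformity_eq_comap_principal`), in which `L` is dense; so it is totally bounded and its
completion is `m L`. For the topology of pointwise convergence the maximal equiuniformity is
`orderUniformity X`, and for the permutation topology it is the uniformity
`discreteOrderUniformity X` induced from `X ⊗ {-1, 0, 1}`, whose entourages are those of the
partitions of `X` into finitely many points and the intervals between them.

*The group.* Both uniformities `u` have the property `TransportsTuples`: if `g x` and `h x` are
close for all `x` in a finite set `s`, then `h = o g` on `s` for some `o` close to the unit, where
the closeness needed does not depend on `s`. This is where ultrahomogeneity enters: a neighbourhood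
of the unit controls finitely many points, and one extends `g x ↦ h x` to these points by an order
isomorphism that moves them little. For one-point sets `s`, this shows that `u` is the finest
equiuniformity (`TransportsTuples.isLeast`). In general, it gives `h = o g k`, where `k` fixes `s`
pointwise; hence the uniformity which `X ^ X` induces on the group is `R_𝒦`
(`TransportsTuples.stabUniformity_eq`), and it is `L ∧ R` if the pointwise stabilizers form a base
of neighbourhoods of the unit (`TransportsTuples.roelckeUniformity_eq`).

*The completions.* A set mapped into a complete Hausdorff space, with the induced uniformity, has
the closure of its image as its completion (`isCompletionVia_closure_range`). For the Ellis
semigroups it remains to see that `(bX) ^ (bX)` induces the same uniformity on the group as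
`X ^ X`, i.e. that all orbit maps `g ↦ g z`, `z ∈ bX`, are uniformly continuous. If `X` is
continuous, then so is `X ⊗ {-1, 0, 1}`; so `z` is an endpoint, which is fixed, or a point of `X`,
or a point `(x, i)`, and the orbit map of the latter is controlled by that of `x`
(`tendsto_toLex_orderUniformity`).
-/

/-! ### The uniformity of a linear order -/

/-- The entourage of the covering `{Iio b, Ioi a}` of a chain, for `a < b`. -/
def orderEntourage {L : Type*} [LinearOrder L] (a b : L) : Set (L × L) :=
  {p | p.1 < b ∧ p.2 < b ∨ a < p.1 ∧ a < p.2}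

/-- Splitting `a < b` at an intermediate point, if there is one, halves the entourage; otherwise
the covering `{Iio b, Ioi a}` is a partition. -/
theorem exists_orderEntourage_comp_subset {L : Type*} [LinearOrder L] {a b : L} (hab : a < b) :
    ∃ s ∈ ⨅ (a : L) (b : L) (_ : a < b), 𝓟 (orderEntourage a b),
      SetRel.comp s s ⊆ orderEntourage a b := by
  have hm : ∀ {a b : L}, a < b →
      orderEntourage a b ∈ ⨅ (a : L) (b : L) (_ : a < b), 𝓟 (orderEntourage a b) :=
    fun {a b} h => mem_iInf_of_mem a <| mem_iInf_of_mem b <| mem_iInf_of_mem h <|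
      mem_principal_self _
  by_cases h : ∃ c, a < c ∧ c < b
  · obtain ⟨c, hac, hcb⟩ := h
    refine ⟨_, inter_mem (hm hac) (hm hcb), ?_⟩
    rintro ⟨x, z⟩ ⟨y, ⟨h1, h2⟩, ⟨h3, h4⟩⟩
    simp only [orderEntourage, mem_ofPred_eq] at *
    grind
  · refine ⟨_, hm hab, ?_⟩
    rintro ⟨x, z⟩ ⟨y, h1, h2⟩
    simp only [orderEntourage, mem_ofPred_eq] at *
    grind

/-- The uniformity of a chain which is generated by the coverings `{Iio b, Ioi a}`, `a < b`. Its
topology is, by definition, the order topology. -/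
@[reducible] def orderUniformity (L : Type*) [LinearOrder L] : UniformSpace L where
  toTopologicalSpace := Preorder.topology L
  uniformity := ⨅ (a : L) (b : L) (_ : a < b), 𝓟 (orderEntourage a b)
  symm := by
    refine tendsto_iInf.2 fun a => tendsto_iInf.2 fun b => tendsto_iInf.2 fun h => ?_
    refine tendsto_principal.2 (mem_iInf_of_mem a <| mem_iInf_of_mem b <| mem_iInf_of_mem h ?_)
    exact fun p hp => hp.imp And.symm And.symm
  comp := by
    refine le_iInf fun a => le_iInf fun b => le_iInf fun h => le_principal_iff.2 ?_
    obtain ⟨s, hs, hsub⟩ := exists_orderEntourage_comp_subset h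
    exact mem_of_superset (mem_lift' hs) hsub
  nhds_eq_comap_uniformity x := by
    let _ : TopologicalSpace L := Preorder.topology L
    have _ : OrderTopology L := ⟨rfl⟩
    simp only [comap_iInf, comap_principal]
    refine le_antisymm ?_ ?_
    · refine le_iInf fun a => le_iInf fun b => le_iInf fun h => le_principal_iff.2 ?_
      rcases lt_or_ge x b with hx | hx
      · exact mem_of_superset (gt_mem_nhds hx) fun y hy => Or.inl ⟨hx, hy⟩
      · exact mem_of_superset (lt_mem_nhds (h.trans_le hx)) fun y hy => Or.inr ⟨h.trans_le hx, hy⟩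
    · rw [nhds_eq_order]
      refine le_inf (le_iInf₂ fun a ha => ?_) (le_iInf₂ fun b hb => ?_)
      · refine iInf_le_of_le a <| iInf_le_of_le x <| iInf_le_of_le ha <| principal_mono.2 ?_
        exact fun y hy => hy.elim (fun h => absurd h.1 (lt_irrefl _)) And.right
      · refine iInf_le_of_le x <| iInf_le_of_le b <| iInf_le_of_le hb <| principal_mono.2 ?_
        exact fun y hy => hy.elim And.right (fun h => absurd h.1 (lt_irrefl _))

theorem uniformity_orderUniformity (L : Type*) [LinearOrder L] :
    𝓤[orderUniformity L] = ⨅ (a : L) (b : L) (_ : a < b), 𝓟 (orderEntourage a b) := rfl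

theorem orderEntourage_mem {L : Type*} [LinearOrder L] {a b : L} (h : a < b) :
    orderEntourage a b ∈ 𝓤[orderUniformity L] :=
  mem_iInf_of_mem a <| mem_iInf_of_mem b <| mem_iInf_of_mem h <| mem_principal_self _

theorem tendsto_orderUniformity {L ι : Type*} [LinearOrder L] {f : ι → L × L} {l : Filter ι}
    (h : ∀ a b, a < b → ∀ᶠ i in l, f i ∈ orderEntourage a b) :
    Tendsto f l (𝓤[orderUniformity L]) :=
  tendsto_iInf.2 fun a => tendsto_iInf.2 fun b => tendsto_iInf.2 fun hab =>
    tendsto_principal.2 (h a b hab)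

/-! ### Cuts of a chain -/

/-- The uniformity of the compact space of cuts; by compactness, it is the only one that is
compatible with the order topology. -/
noncomputable instance (L : Type*) [LinearOrder L] : UniformSpace (DedekindCut L) :=
  orderUniformity (DedekindCut L)


theorem orderUniformity_eq_comap_principal (L : Type*) [LinearOrder L] :
    orderUniformity L =
      UniformSpace.comap DedekindCut.principal (orderUniformity (DedekindCut L)) := by
  refine UniformSpace.ext (le_antisymm ?_ ?_)
  · rw [uniformity_comap, ← tendsto_iff_comap]
    refine tendsto_orderUniformity fun a b hab => ?_
    obtain ⟨q, haq, hqb⟩ := DedekindCut.lt_iff_exists.1 hab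
    obtain ⟨p, hap, hpq⟩ := DedekindCut.lt_iff_exists'.1 haq
    filter_upwards [orderEntourage_mem (DedekindCut.principal_lt_principal.1 hpq)] with x hx
    refine hx.imp (fun h => ?_) (fun h => ?_)
    · exact ⟨(DedekindCut.principal_lt_principal.2 h.1).trans_le hqb,
        (DedekindCut.principal_lt_principal.2 h.2).trans_le hqb⟩
    · exact ⟨hap.trans_lt (DedekindCut.principal_lt_principal.2 h.1),
        hap.trans_lt (DedekindCut.principal_lt_principal.2 h.2)⟩
  · rw [uniformity_comap, uniformity_orderUniformity L]
    refine le_iInf fun a => le_iInf fun b => le_iInf fun h => le_principal_iff.2 ?_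
    refine mem_of_superset (preimage_mem_comap
      (orderEntourage_mem (DedekindCut.principal_lt_principal.2 h))) fun p hp => ?_
    exact hp.imp (fun h => ⟨DedekindCut.principal_lt_principal.1 h.1,
        DedekindCut.principal_lt_principal.1 h.2⟩)
      (fun h => ⟨DedekindCut.principal_lt_principal.1 h.1,
        DedekindCut.principal_lt_principal.1 h.2⟩)

theorem DedekindCut.denseRange_principal (L : Type*) [LinearOrder L] [Nonempty L] :
    DenseRange (principal : L → DedekindCut L) := by
  intro z
  by_cases h : z.left.Nonempty
  · have hlub : IsLUB (principal '' z.left) z := by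
      refine ⟨?_, fun c hc => ?_⟩
      · rintro _ ⟨x, hx, rfl⟩
        exact principal_le_iff.2 hx
      · exact Concept.extent_subset_extent_iff.1 fun x hx =>
          principal_le_iff.1 (hc (mem_image_of_mem _ hx))
    exact closure_mono (image_subset_range _ _) (hlub.mem_closure (h.image _))
  · have hr : z.right = univ := by
      rw [← upperBounds_left, not_nonempty_iff_eq_empty.1 h, upperBounds_empty]
    have hglb : IsGLB (range (principal : L → DedekindCut L)) z := by
      refine ⟨?_, fun c hc => ?_⟩
      · rintro _ ⟨x, rfl⟩
        exact le_principal_iff.2 (hr ▸ mem_univ x)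
      · exact Concept.intent_subset_intent_iff.1 fun x _ =>
          le_principal_iff.1 (hc (mem_range_self x))
    exact hglb.mem_closure (range_nonempty _)

theorem cutMap_principal {L : Type*} [LinearOrder L] (f : L ≃o L) (x : L) :
    cutMap f (DedekindCut.principal x) = DedekindCut.principal (f x) :=
  DedekindCut.factorEmbedding_principal _ x

/-- The left set of the cut `cutMap f z` is the image under `f` of the left set of `z`. -/
theorem apply_mem_left_cutMap {L : Type*} [LinearOrder L] (f : L ≃o L) (z : DedekindCut L)
    (x : L) : f x ∈ (cutMap f z).left ↔ x ∈ z.left := by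
  rw [← DedekindCut.principal_le_iff, ← DedekindCut.principal_le_iff]
  rw [← cutMap_principal]
  exact OrderEmbedding.le_iff_le _

theorem cutMap_cutMap_symm {L : Type*} [LinearOrder L] (f : L ≃o L) (z : DedekindCut L) :
    cutMap f (cutMap f.symm z) = z := by
  refine DedekindCut.ext (Set.ext fun y => ?_)
  have h := apply_mem_left_cutMap f (cutMap f.symm z) (f.symm y)
  rwa [f.apply_symm_apply, apply_mem_left_cutMap f.symm] at h

/-- `cutMap f` as an automorphism of the chain of cuts. -/
noncomputable def cutIso {L : Type*} [LinearOrder L] (f : L ≃o L) :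
    DedekindCut L ≃o DedekindCut L :=
  RelIso.ofSurjective
    (DedekindCut.factorEmbedding (f.toOrderEmbedding.trans DedekindCut.principalEmbedding))
    fun z => ⟨cutMap f.symm z, cutMap_cutMap_symm f z⟩

theorem continuous_cutMap {L : Type*} [LinearOrder L] (f : L ≃o L) : Continuous (cutMap f) :=
  (cutIso f).continuous

theorem cutMap_bot {L : Type*} [LinearOrder L] (f : L ≃o L) : cutMap f ⊥ = ⊥ :=
  (cutIso f).map_bot

theorem cutMap_top {L : Type*} [LinearOrder L] (f : L ≃o L) : cutMap f ⊤ = ⊤ :=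
  (cutIso f).map_top

/-- In a continuous chain, only the two improper gaps are filled. -/
theorem IsContinuousChain.eq_bot_or_eq_top_or_principal {L : Type*} [LinearOrder L]
    (hL : IsContinuousChain L) (z : DedekindCut L) :
    z = ⊥ ∨ z = ⊤ ∨ ∃ x, z = DedekindCut.principal x := by
  have hmax : ∀ a, IsGreatest z.left a → z = DedekindCut.principal a := fun a ha =>
    le_antisymm (Concept.extent_subset_extent_iff.1 fun x hx => ha.2 hx)
      (DedekindCut.principal_le_iff.2 ha.1)
  by_cases h1 : z.left.Nonempty
  swap
  · left
    refine le_bot_iff.1 (Concept.extent_subset_extent_iff.1 fun x hx => absurd ⟨x, hx⟩ h1)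
  by_cases h2 : z.leftᶜ.Nonempty
  swap
  · right; left
    refine top_le_iff.1 (Concept.extent_subset_extent_iff.1 fun x _ => ?_)
    exact not_not.1 fun hx => h2 ⟨x, hx⟩
  refine Or.inr (Or.inr ?_)
  by_cases hg : ∃ a, IsGreatest z.left a
  · exact hg.imp hmax
  obtain ⟨b, hb⟩ := (hL z.left (Concept.isLowerSet_extent_le z) h1 h2).resolve_left hg
  refine ⟨b, le_antisymm ?_ ?_⟩
  · rw [DedekindCut.le_principal_iff, ← DedekindCut.upperBounds_left]
    exact fun x hx => le_of_not_gt fun h => hb.1 (Concept.isLowerSet_extent_le z h.le hx)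
  · refine Concept.intent_subset_intent_iff.1 fun y hy => hb.2 fun hy' => hg ⟨y, hy', ?_⟩
    exact z.upperBounds_left ▸ hy

/-! ### Completions of induced uniformities -/

instance {α : Type*} (u : UniformSpace α) : CompleteSpace (UComp u) :=
  @UniformSpace.Completion.completeSpace α u

instance {α : Type*} (u : UniformSpace α) : T0Space (UComp u) :=
  @UniformSpace.Completion.t0Space α u

theorem UComp.denseRange_of {α : Type*} (u : UniformSpace α) : DenseRange (UComp.of u) :=
  @UniformSpace.Completion.denseRange_coe α u

theorem UComp.comap_of {α : Type*} (u : UniformSpace α) :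
    u = UniformSpace.comap (UComp.of u) inferInstance :=
  (@UniformSpace.Completion.isUniformInducing_coe α u).comap_uniformSpace.symm

theorem UComp.uniformity_eq {α : Type*} (u : UniformSpace α) :
    𝓤[u] = comap (fun p : α × α => (UComp.of u p.1, UComp.of u p.2)) (𝓤 (UComp u)) :=
  congrArg (fun v : UniformSpace α => 𝓤[v]) (UComp.comap_of u)

/-- A set mapped densely into a complete Hausdorff space has this space as its completion with
respect to the induced uniformity. -/
theorem exists_uniformEquiv_of_denseRange {α Y : Type*} [UniformSpace Y] [CompleteSpace Y]
    [T0Space Y] {u : UniformSpace α} {j : α → Y} (hu : u = UniformSpace.comap j inferInstance)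
    (hj : DenseRange j) : ∃ e : UComp u ≃ᵤ Y, ∀ a, e (UComp.of u a) = j a := by
  let pkg : AbstractCompletion α :=
    { space := Y, coe := j, uniformStruct := inferInstance, complete := inferInstance
      separation := inferInstance, isUniformInducing := ⟨by rw [hu]; rfl⟩, dense := hj }
  exact ⟨UniformSpace.Completion.cPkg.compareEquiv pkg,
    fun a => UniformSpace.Completion.cPkg.compare_coe pkg a⟩

theorem isCompletionVia_closure_range {α Y : Type*} [UniformSpace Y] [CompleteSpace Y]
    [T0Space Y] {u : UniformSpace α} {j : α → Y} (hu : u = UniformSpace.comap j inferInstance) :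
    IsCompletionVia u j (closure (range j)) := by
  have _ : CompleteSpace (closure (range j)) := isClosed_closure.completeSpace_coe
  let k : α → closure (range j) := fun a => ⟨j a, subset_closure (mem_range_self a)⟩
  have hk : u = UniformSpace.comap k inferInstance := by
    rw [hu]; exact UniformSpace.comap_comap (f := k) (g := Subtype.val)
  have hd : DenseRange k := by
    intro z
    rw [closure_subtype, ← range_comp]
    exact z.2
  obtain ⟨e, he⟩ := exists_uniformEquiv_of_denseRange hk hd
  exact ⟨e, fun a => by rw [he]⟩

theorem IsCompletionVia.compactSpace {α Y : Type*} [UniformSpace Y] [CompactSpace Y]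
    {u : UniformSpace α} {j : α → Y} {S : Set Y} (h : IsCompletionVia u j S) (hS : IsClosed S) :
    CompactSpace (UComp u) := by
  obtain ⟨e, -⟩ := h
  have _ : CompactSpace S := isCompact_iff_compactSpace.1 hS.isCompact
  exact e.symm.toHomeomorph.compactSpace

/-- A uniformity which is induced by a map into a compact space is totally bounded. -/
theorem totallyBounded_univ_of_eq_comap {α K : Type*} [UniformSpace K] [CompactSpace K]
    {u : UniformSpace α} {j : α → K} (hu : u = UniformSpace.comap j inferInstance) :
    @TotallyBounded α u univ := by
  have h : @IsUniformInducing α K u _ j := ⟨by rw [hu]; rfl⟩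
  simpa using @totallyBounded_preimage α K u _ j univ h isCompact_univ.totallyBounded

/-! ### Equiuniformities -/

section Extension
variable {G X : Type*} [Group G] [MulAction G X] {u : UniformSpace X}

theorem extMap_of (hu : ∀ g : G, UniformContinuous[u, u] fun x => g • x) (g : G) (x : X) :
    extMap u g (UComp.of u x) = UComp.of u (g • x) :=
  UniformSpace.Completion.map_coe (hu g) x

theorem continuous_extMap (g : G) : Continuous (extMap u g) :=
  UniformSpace.Completion.continuous_map

theorem extMap_mul (hu : ∀ g : G, UniformContinuous[u, u] fun x => g • x) (g h : G)
    (z : UComp u) : extMap u (g * h) z = extMap u g (extMap u h z) := by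
  refine congrFun ((UComp.denseRange_of u).equalizer (continuous_extMap _)
    ((continuous_extMap g).comp (continuous_extMap h)) (funext fun x => ?_)) z
  simp only [Function.comp_apply, extMap_of hu, mul_smul]

end Extension

section Equiuniformity
variable {G X : Type*} [Group G] [TopologicalSpace G] [MulAction G X]
  {tX : TopologicalSpace X} {u : UniformSpace X}

/-- The boundedness of an equiuniformity says that `(g, x, z) ↦ (x, g z)` tends to the diagonal as
`g` tends to the unit and `(x, z)` tends to the diagonal. -/
theorem IsEquiuniformity.tendsto_smul (h : IsEquiuniformity G tX u) :
    Tendsto (fun p : G × X × X => (p.2.1, p.1 • p.2.2)) (𝓝 1 ×ˢ 𝓤[u]) (𝓤[u]) := by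
  intro W hW
  obtain ⟨W', hW', hsymm, hcomp⟩ := @comp_symm_mem_uniformity_sets X u W hW
  obtain ⟨O, hO, V, hV, hOV⟩ := h.bounded W' hW'
  refine mem_map.2 (mem_of_superset (prod_mem_prod hO hV) ?_)
  rintro ⟨g, x, z⟩ ⟨hg, hxz⟩
  obtain ⟨y, hy⟩ := hOV x
  have h1 := hy 1 (mem_of_mem_nhds hO) x (@refl_mem_uniformity X u x V hV)
  rw [one_smul] at h1
  exact hcomp ⟨y, hsymm.symm _ _ h1, hy g hg z hxz⟩

theorem IsEquiuniformity.of_tendsto (h1 : u.toTopologicalSpace = tX)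
    (h2 : ∀ g : G, UniformContinuous[u, u] fun x => g • x)
    (h3 : Tendsto (fun p : G × X × X => (p.2.1, p.1 • p.2.2)) (𝓝 1 ×ˢ 𝓤[u]) (𝓤[u])) :
    IsEquiuniformity G tX u where
  compatible := h1
  saturated := h2
  bounded W hW := by
    obtain ⟨O, hO, V, hV, hOV⟩ := mem_prod_iff.1 (h3 hW)
    exact ⟨O, hO, V, hV, fun x => ⟨x, fun g hg z hz => hOV (mk_mem_prod hg hz)⟩⟩

/-- The action of `G` extends continuously to the completion with respect to an
equiuniformity. -/
theorem IsEquiuniformity.continuous_extMap [IsTopologicalGroup G] (h : IsEquiuniformity G tX u) :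
    Continuous fun p : G × UComp u => extMap u p.1 p.2 := by
  -- closed entourages of the completion reduce continuity at the unit to the boundedness on `X`
  have hone : ∀ z : UComp u,
      Tendsto (fun p : G × UComp u => extMap u p.1 p.2) (𝓝 1 ×ˢ 𝓝 z) (𝓝 z) := by
    intro z
    refine Uniform.tendsto_nhds_right.2 fun W hW => ?_
    obtain ⟨W', ⟨hW', hc⟩, hsub⟩ := uniformity_hasBasis_closed.mem_iff.1 hW
    have hW0 : (fun p : X × X => (UComp.of u p.1, UComp.of u p.2)) ⁻¹' W' ∈ 𝓤[u] := by
      rw [UComp.uniformity_eq u]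
      exact preimage_mem_comap hW'
    obtain ⟨O, hO, V, hV, hOV⟩ := mem_prod_iff.1 (h.tendsto_smul hW0)
    rw [UComp.uniformity_eq u] at hV
    obtain ⟨V', hV', hVsub⟩ := hV
    obtain ⟨V1, ⟨hV1, hVo⟩, hV1sub⟩ := uniformity_hasBasis_open.mem_iff.1 hV'
    refine mem_map.2 (mem_of_superset (prod_mem_prod hO (mem_nhds_left z hV1)) ?_)
    rintro ⟨g, w⟩ ⟨hg, hw⟩
    refine hsub ?_
    have hcont : Continuous fun q : UComp u × UComp u => (q.1, extMap u g q.2) :=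
      continuous_fst.prodMk ((_root_.continuous_extMap g).comp continuous_snd)
    have hd : DenseRange (Prod.map (UComp.of u) (UComp.of u)) :=
      (UComp.denseRange_of u).prodMap (UComp.denseRange_of u)
    have hcl : V1 ⊆ closure (V1 ∩ range (Prod.map (UComp.of u) (UComp.of u))) :=
      hd.open_subset_closure_inter hVo
    have key : V1 ∩ range (Prod.map (UComp.of u) (UComp.of u)) ⊆
        (fun q : UComp u × UComp u => (q.1, extMap u g q.2)) ⁻¹' W' := by
      rintro _ ⟨hq, ⟨x, y⟩, rfl⟩
      have := hOV (mk_mem_prod hg (hVsub (hV1sub hq) : (x, y) ∈ V))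
      simpa [extMap_of h.saturated] using this
    exact closure_minimal key (hc.preimage hcont) (hcl hw)
  -- near `(g, z)` the action is `g` composed with the action near `(1, z)`
  refine continuous_iff_continuousAt.2 fun ⟨g, z⟩ => ?_
  have h1 : Tendsto (fun p : G × UComp u => (g⁻¹ * p.1, p.2)) (𝓝 (g, z)) (𝓝 1 ×ˢ 𝓝 z) := by
    rw [← nhds_prod_eq]
    have : Continuous fun p : G × UComp u => (g⁻¹ * p.1, p.2) := by fun_prop
    simpa using this.tendsto (g, z)
  have h2 := ((_root_.continuous_extMap (u := u) g).tendsto z).comp ((hone z).comp h1)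
  refine h2.congr fun p => ?_
  simp only [Function.comp_apply]
  rw [← extMap_mul h.saturated, mul_inv_cancel_left]

end Equiuniformity

/-! ### The uniformity induced on the group from the powers of the space and its completion -/

section Induced
variable {G X : Type*} [Group G] [MulAction G X] {u : UniformSpace X}

theorem ellisUniformity_eq_iInf (u : UniformSpace X) :
    ellisUniformity G u = ⨅ x : X, UniformSpace.comap (fun g : G => g • x) u := by
  rw [ellisUniformity, Pi.uniformSpace_eq, UniformSpace.comap_iInf]
  simp only [UniformSpace.comap_comap.symm]
  rfl

theorem ellisUniformity_eq_comap_orbitMap (u : UniformSpace X) :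
    ellisUniformity G u = UniformSpace.comap (orbitMap (G := G) u) inferInstance := by
  rw [ellisUniformity_eq_iInf, Pi.uniformSpace_eq, UniformSpace.comap_iInf]
  refine iInf_congr fun x => ?_
  conv_lhs => rw [UComp.comap_of u]
  simp only [← UniformSpace.comap_comap]
  rfl

/-- Entourages of the uniformity on `G` induced from `X ^ X` are determined by an entourage on `X`
and a finite subset of `X`. -/
theorem mem_uniformity_ellisUniformity {V : Set (X × X)} (hV : V ∈ 𝓤[u]) (s : Finset X) :
    {p : G × G | ∀ x ∈ s, (p.1 • x, p.2 • x) ∈ V} ∈ 𝓤[ellisUniformity G u] := by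
  rw [ellisUniformity_eq_iInf, iInf_uniformity]
  refine (s.eventually_all (l := ⨅ x : X, 𝓤[UniformSpace.comap (fun g : G => g • x) u])
    (p := fun x (p : G × G) => (p.1 • x, p.2 • x) ∈ V)).2 fun x _ => ?_
  refine mem_iInf_of_mem x ?_
  rw [uniformity_comap]
  exact preimage_mem_comap hV

theorem le_ellisUniformity {v : UniformSpace G}
    (h : ∀ x : X, Tendsto (fun p : G × G => (p.1 • x, p.2 • x)) (𝓤[v]) (𝓤[u])) :
    v ≤ ellisUniformity G u := by
  rw [ellisUniformity_eq_iInf]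
  exact le_iInf fun x => uniformContinuous_iff_le_comap.1 (h x)

theorem uniformContinuous_smul_ellisUniformity (u : UniformSpace X) (x : X) :
    UniformContinuous[ellisUniformity G u, u] fun g : G => g • x := by
  rw [ellisUniformity_eq_iInf]
  exact uniformContinuous_iff_le_comap.2 (iInf_le _ x)

/-- If the orbit maps of all points of the completion are uniformly continuous, then the powers
`X ^ X` and `(bX) ^ (bX)` induce the same uniformity on `G`. -/
theorem ellisUniformity_eq_comap_extMap
    (hu : ∀ g : G, UniformContinuous[u, u] fun x => g • x)
    (h : ∀ z : UComp u, UniformContinuous[ellisUniformity G u, inferInstance]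
      fun g : G => extMap u g z) :
    ellisUniformity G u = UniformSpace.comap (extMap (G := G) u) inferInstance := by
  rw [Pi.uniformSpace_eq, UniformSpace.comap_iInf]
  refine le_antisymm (le_iInf fun z => ?_) ?_
  · rw [← UniformSpace.comap_comap]
    exact uniformContinuous_iff_le_comap.1 (h z)
  · rw [ellisUniformity_eq_comap_orbitMap, Pi.uniformSpace_eq, UniformSpace.comap_iInf]
    refine le_iInf fun x => iInf_le_of_le (UComp.of u x) (le_of_eq ?_)
    rw [← UniformSpace.comap_comap, ← UniformSpace.comap_comap]
    refine congrArg (fun f => UniformSpace.comap f _) (funext fun g => ?_)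
    exact extMap_of hu g x

end Induced

/-! ### Transport of finite tuples -/

/-- Elements of the group which are close to each other on a finite set, with respect to the
uniformity `u`, differ on this set by a factor (on the left) from a given neighbourhood of the
unit. The closeness that is needed does not depend on the finite set. -/
def TransportsTuples (G : Type*) {X : Type*} [Group G] [TopologicalSpace G] [MulAction G X]
    (u : UniformSpace X) : Prop :=
  ∀ O ∈ 𝓝 (1 : G), ∃ V ∈ 𝓤[u], ∀ (s : Finset X) (g h : G),
    (∀ x ∈ s, (g • x, h • x) ∈ V) → ∃ o ∈ O, ∀ x ∈ s, (o * g) • x = h • x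

section Transport
variable {G X : Type*} [Group G] [TopologicalSpace G] [MulAction G X]
  {tX : TopologicalSpace X} {u : UniformSpace X}

/-- An equiuniformity is the finest one as soon as points close to each other can be exchanged by
group elements close to the unit. -/
theorem TransportsTuples.isLeast (ht : TransportsTuples G u) (hu : IsEquiuniformity G tX u)
    [MulAction.IsPretransitive G X] : IsLeast {v | IsEquiuniformity G tX v} u := by
  refine ⟨hu, fun v hv W hW => ?_⟩
  obtain ⟨O, hO, V, hV, hOV⟩ := mem_prod_iff.1 (hv.tendsto_smul hW)
  obtain ⟨V', hV', hV''⟩ := ht O hO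
  refine mem_of_superset hV' ?_
  rintro ⟨x, y⟩ hxy
  obtain ⟨k, rfl⟩ := MulAction.exists_smul_eq G x y
  obtain ⟨o, ho, hox⟩ := hV'' {x} 1 k (by simpa using hxy)
  have := hOV (mk_mem_prod ho (@refl_mem_uniformity X v x V hV))
  simpa [show o • x = k • x by simpa using hox] using this

variable [IsTopologicalGroup G]

theorem stabEntourage_mem {O : Set G} (hO : O ∈ 𝓝 1) (s : Finset X) :
    stabEntourage O s ∈ 𝓤[stabUniformity G X] :=
  FilterBasis.mem_filter_of_mem _ ⟨O, hO, s, rfl⟩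

theorem exists_stabEntourage_subset {E : Set (G × G)} (hE : E ∈ 𝓤[stabUniformity G X]) :
    ∃ O ∈ 𝓝 (1 : G), ∃ s : Finset X, stabEntourage O s ⊆ E := by
  obtain ⟨_, ⟨O, hO, s, rfl⟩, h⟩ := (FilterBasis.mem_filter_iff _).1 hE
  exact ⟨O, hO, s, h⟩

theorem TransportsTuples.stabUniformity_eq (ht : TransportsTuples G u)
    (hu : IsEquiuniformity G tX u) : stabUniformity G X = ellisUniformity G u := by
  refine UniformSpace.ext (le_antisymm ?_ ?_)
  · refine le_ellisUniformity fun x W hW => ?_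
    obtain ⟨W', hW', hsymm, hcomp⟩ := @comp_symm_mem_uniformity_sets X u W hW
    obtain ⟨O, hO, V, hV, hOV⟩ := mem_prod_iff.1 (hu.tendsto_smul hW')
    have hclose : ∀ y : X, ∀ o ∈ O, (y, o • y) ∈ W' := fun y o ho =>
      hOV (mk_mem_prod ho (@refl_mem_uniformity X u y V hV))
    refine mem_map.2 (mem_of_superset (stabEntourage_mem hO {x}) ?_)
    rintro ⟨a, b⟩ ⟨g, ⟨o, ho, k, hk, rfl⟩, ⟨o', ho', k', hk', rfl⟩⟩
    have hkx : k • x = x := (mem_fixingSubgroup_iff G).1 hk x (by simp)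
    have hkx' : k' • x = x := (mem_fixingSubgroup_iff G).1 hk' x (by simp)
    refine hcomp ⟨g • x, hsymm.symm _ _ ?_, ?_⟩
    · simpa [mul_smul, hkx] using hclose (g • x) o ho
    · simpa [mul_smul, hkx'] using hclose (g • x) o' ho'
  · intro E hE
    obtain ⟨O, hO, s, hs⟩ := exists_stabEntourage_subset hE
    obtain ⟨V, hV, hVt⟩ := ht O hO
    refine mem_of_superset (mem_uniformity_ellisUniformity hV s) ?_
    rintro ⟨g, h⟩ hgh
    obtain ⟨o, ho, hox⟩ := hVt s g h hgh
    refine hs ⟨g, ⟨1, mem_of_mem_nhds hO, 1, one_mem _, by simp⟩,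
      ⟨o, ho, (o * g)⁻¹ * h, ?_, by group⟩⟩
    refine (mem_fixingSubgroup_iff G).2 fun x hx => ?_
    rw [mul_smul, ← hox x (by exact_mod_cast hx), inv_smul_smul]

/-- If the pointwise stabilizers of finite sets form a base of neighbourhoods of the unit, then the
factors which are needed to pass from `g` to a near `h` are small elements on the left, and small
elements on the right: the Roelcke uniformity is induced from `X ^ X`. -/
theorem TransportsTuples.roelckeUniformity_eq (ht : TransportsTuples G u)
    (hu : IsEquiuniformity G tX u)
    (hopen : ∀ s : Finset X, (fixingSubgroup G (s : Set X) : Set G) ∈ 𝓝 1)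
    (hbase : ∀ O ∈ 𝓝 (1 : G), ∃ s : Finset X, (fixingSubgroup G (s : Set X) : Set G) ⊆ O) :
    roelckeUniformity G = ellisUniformity G u := by
  refine le_antisymm (sup_le ?_ ?_) ?_
  · refine le_ellisUniformity fun x W hW => ?_
    refine mem_map.2 (mem_of_superset (preimage_mem_comap (hopen {x})) ?_)
    rintro ⟨g, h⟩ hgh
    have hx : (g⁻¹ * h) • x = x := (mem_fixingSubgroup_iff G).1 hgh x (by simp)
    rw [mul_smul, inv_smul_eq_iff] at hx
    simpa [hx] using @refl_mem_uniformity X u (g • x) W hW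
  · refine le_ellisUniformity fun x W hW => ?_
    obtain ⟨O, hO, V, hV, hOV⟩ := mem_prod_iff.1 (hu.tendsto_smul hW)
    refine mem_map.2 (mem_of_superset (preimage_mem_comap hO) ?_)
    rintro ⟨g, h⟩ hgh
    have := hOV (mk_mem_prod hgh (@refl_mem_uniformity X u (g • x) V hV))
    simpa [mul_smul] using this
  · intro E hE
    obtain ⟨E', hE', hcomp⟩ := @comp_mem_uniformity_sets G (roelckeUniformity G) E hE
    have hl : E' ∈ 𝓤[IsTopologicalGroup.leftUniformSpace G] :=
      (le_sup_left : IsTopologicalGroup.leftUniformSpace G ≤ roelckeUniformity G) hE'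
    have hr : E' ∈ 𝓤[IsTopologicalGroup.rightUniformSpace G] :=
      (le_sup_right : IsTopologicalGroup.rightUniformSpace G ≤ roelckeUniformity G) hE'
    obtain ⟨N, hN, hNE⟩ := mem_comap.1 hl
    obtain ⟨O, hO, hOE⟩ := mem_comap.1 hr
    obtain ⟨s, hs⟩ := hbase N hN
    obtain ⟨V, hV, hVt⟩ := ht O hO
    refine mem_of_superset (mem_uniformity_ellisUniformity hV s) ?_
    rintro ⟨g, h⟩ hgh
    obtain ⟨o, ho, hox⟩ := hVt s g h hgh
    refine hcomp ⟨o * g, hOE (by simpa using ho), hNE (hs ?_)⟩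
    refine (mem_fixingSubgroup_iff G).2 fun x hx => ?_
    rw [mul_smul, ← hox x (by exact_mod_cast hx), inv_smul_smul]

end Transport

/-! ### Ultrahomogeneous chains -/

section Chain
variable {X : Type*} [LinearOrder X]

/-- An isomorphism between finite subchains, given by two families which enumerate them in the
same order, extends to an automorphism. -/
theorem IsUltrahomogeneous.exists_orderIso (hX : IsUltrahomogeneous X) {ι : Type*} [Finite ι]
    (p q : ι → X) (h : ∀ i j, p i < p j ↔ q i < q j) : ∃ g : X ≃o X, ∀ i, g (p i) = q i := by
  classical
  have _ := Fintype.ofFinite ι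
  let e := (Finset.univ.image p).orderEmbOfFin rfl
  have hp : ∀ k, ∃ i, p i = e k := fun k => by
    have hk := (Finset.univ.image p).orderEmbOfFin_mem rfl k
    obtain ⟨i, -, hi⟩ := Finset.mem_image.1 hk
    exact ⟨i, hi⟩
  choose i hi using hp
  obtain ⟨g, hg⟩ := hX _ e (q ∘ i) e.strictMono fun k l hkl =>
    (h _ _).1 (by rw [hi, hi]; exact e.strictMono hkl)
  refine ⟨g, fun j => ?_⟩
  obtain ⟨k, hk⟩ : p j ∈ range e := by
    rw [Finset.range_orderEmbOfFin]; simp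
  have hij : p (i k) = p j := (hi k).trans hk
  rw [← hk, hg]
  refine le_antisymm (not_lt.1 fun hl => ?_) (not_lt.1 fun hl => ?_)
  · exact ((h _ _).2 hl).ne hij.symm
  · exact ((h _ _).2 hl).ne hij

theorem IsUltrahomogeneous.exists_apply_eq (hX : IsUltrahomogeneous X) (x y : X) :
    ∃ g : X ≃o X, g x = y := by
  obtain ⟨g, hg⟩ := hX.exists_orderIso (ι := Unit) (fun _ => x) (fun _ => y) (by simp)
  exact ⟨g, hg ()⟩

theorem IsUltrahomogeneous.noMaxOrder [Nontrivial X] (hX : IsUltrahomogeneous X) :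
    NoMaxOrder X := by
  refine ⟨fun x => ?_⟩
  obtain ⟨a, b, hab⟩ := exists_pair_lt X
  obtain ⟨g, rfl⟩ := hX.exists_apply_eq a x
  exact ⟨g b, g.lt_iff_lt.2 hab⟩

theorem IsUltrahomogeneous.noMinOrder [Nontrivial X] (hX : IsUltrahomogeneous X) :
    NoMinOrder X := by
  refine ⟨fun x => ?_⟩
  obtain ⟨a, b, hab⟩ := exists_pair_lt X
  obtain ⟨g, rfl⟩ := hX.exists_apply_eq b x
  exact ⟨g a, g.lt_iff_lt.2 hab⟩

theorem IsUltrahomogeneous.denselyOrdered [Nontrivial X] (hX : IsUltrahomogeneous X) :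
    DenselyOrdered X := by
  have _ := hX.noMinOrder
  refine ⟨fun a b hab => ?_⟩
  obtain ⟨c, hca⟩ := exists_lt a
  -- an automorphism which fixes `b` and maps `c < a` to `a` maps `a` between `a` and `b`
  obtain ⟨g, hg⟩ := hX.exists_orderIso (ι := Bool) (fun i => cond i b c) (fun i => cond i b a)
    (by simp [hab, hab.not_gt, hca.trans hab, (hca.trans hab).not_gt])
  have h1 : g c = a := hg false
  have h2 : g b = b := hg true
  exact ⟨g a, h1.symm.trans_lt (g.lt_iff_lt.2 hca), (g.lt_iff_lt.2 hab).trans_eq h2⟩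

/-! ### The topology of pointwise convergence -/

theorem AutPt.exists_subset_of_mem_nhds_one [NoMinOrder X] [NoMaxOrder X] {O : Set (AutPt X)}
    (hO : O ∈ 𝓝 1) : ∃ (T : Finset X) (a b : X → X), (∀ t ∈ T, a t < t ∧ t < b t) ∧
      {o : AutPt X | ∀ t ∈ T, a t < o • t ∧ o • t < b t} ⊆ O := by
  let _ : TopologicalSpace X := Preorder.topology X
  have _ : OrderTopology X := ⟨rfl⟩
  rw [nhds_induced, mem_comap] at hO
  obtain ⟨N, hN, hNO⟩ := hO
  rw [nhds_pi, Filter.mem_pi] at hN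
  obtain ⟨T, hT, U, hU, hUN⟩ := hN
  have hU' : ∀ t, ∃ a b, (a < t ∧ t < b) ∧ Ioo a b ⊆ U t := fun t => by
    obtain ⟨a, b, ht, h⟩ := mem_nhds_iff_exists_Ioo_subset.1 (hU t)
    exact ⟨a, b, by simpa using ht, h⟩
  choose a b hab hsub using hU'
  refine ⟨hT.toFinset, a, b, fun t _ => hab t, fun o ho => hNO (hUN fun t ht => hsub t ?_)⟩
  exact ho t (by simpa using ht)

theorem AutPt.tendsto_smul_orderUniformity [DenselyOrdered X] :
    Tendsto (fun p : AutPt X × X × X => (p.2.1, p.1 • p.2.2))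
      (𝓝 1 ×ˢ 𝓤[orderUniformity X]) (𝓤[orderUniformity X]) := by
  refine tendsto_orderUniformity fun a b hab => ?_
  obtain ⟨c, hac, hcb⟩ := exists_between hab
  have h1 : ∀ᶠ g : AutPt X in 𝓝 1, a < g • c ∧ g • c < b :=
    (AutPt.eventually_gt 1 (by simpa using hac)).and (AutPt.eventually_lt 1 (by simpa using hcb))
  have h2 := (eventually_of_mem (orderEntourage_mem hac) fun _ h => h).and
    (eventually_of_mem (orderEntourage_mem hcb) fun _ h => h)
  filter_upwards [h1.prod_mk h2] with p hp
  obtain ⟨g, x, z⟩ := p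
  obtain ⟨⟨hg1, hg2⟩, h3, h4⟩ := hp
  have hlt : z < c → g • z < b := fun h => ((AutPt.smul_lt_smul_iff g).2 h).trans hg2
  have hgt : c < z → a < g • z := fun h => hg1.trans ((AutPt.smul_lt_smul_iff g).2 h)
  simp only [orderEntourage, mem_ofPred_eq] at h3 h4 ⊢
  grind

theorem AutPt.uniformContinuous_smul (g : AutPt X) :
    UniformContinuous[orderUniformity X, orderUniformity X] fun x => g • x := by
  refine tendsto_orderUniformity fun a b hab => ?_
  have h : g⁻¹ • a < g⁻¹ • b := (AutPt.smul_lt_smul_iff _).2 hab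
  filter_upwards [orderEntourage_mem h] with p hp
  have h1 : ∀ {x y : X}, x < g⁻¹ • y → g • x < y := fun {x y} h => by
    simpa using (AutPt.smul_lt_smul_iff g).2 h
  have h2 : ∀ {x y : X}, g⁻¹ • y < x → y < g • x := fun {x y} h => by
    simpa using (AutPt.smul_lt_smul_iff g).2 h
  exact hp.imp (fun h => ⟨h1 h.1, h1 h.2⟩) (fun h => ⟨h2 h.1, h2 h.2⟩)

theorem AutPt.isEquiuniformity [DenselyOrdered X] :
    IsEquiuniformity (AutPt X) (Preorder.topology X) (orderUniformity X) :=
  .of_tendsto rfl AutPt.uniformContinuous_smul AutPt.tendsto_smul_orderUniformity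

/-- Finitely many points of a dense chain without endpoints, and a neighbourhood of each, have
pairwise disjoint neighbourhoods `Ioo (c t) (d t)` inside the given ones. -/
theorem exists_separated_intervals [DenselyOrdered X] [NoMinOrder X] [NoMaxOrder X] [Nonempty X]
    (T : Finset X) (a b : X → X) (hab : ∀ t ∈ T, a t < t ∧ t < b t) :
    ∃ c d : X → X, (∀ t ∈ T, a t < c t ∧ c t < t ∧ t < d t ∧ d t < b t) ∧
      ∀ t ∈ T, ∀ t' ∈ T, t < t' → d t < c t' := by
  classical
  have hc : ∀ t, ∃ c, t ∈ T → a t < c ∧ c < t ∧ ∀ t' ∈ T, t' < t → t' < c := fun t => by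
    by_cases ht : t ∈ T
    · obtain ⟨c, h1, h2⟩ := Order.exists_between_finsets (insert (a t) (T.filter (· < t))) {t}
        (by simp [(hab t ht).1])
      simp only [Finset.mem_insert, Finset.mem_filter, Finset.mem_singleton] at h1 h2
      exact ⟨c, fun _ => ⟨h1 _ (Or.inl rfl), h2 t rfl, fun t' h h' => h1 t' (Or.inr ⟨h, h'⟩)⟩⟩
    · exact ⟨t, fun h => absurd h ht⟩
  choose c hc using hc
  have hd : ∀ t, ∃ d, t ∈ T → t < d ∧ d < b t ∧ ∀ t' ∈ T, t < t' → d < c t' := fun t => by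
    by_cases ht : t ∈ T
    · obtain ⟨d, h1, h2⟩ := Order.exists_between_finsets {t}
        (insert (b t) ((T.filter (t < ·)).image c)) (by
          simp only [Finset.mem_insert, Finset.mem_image, Finset.mem_filter, Finset.mem_singleton]
          rintro _ rfl y (rfl | ⟨t', ⟨h, h'⟩, rfl⟩)
          · exact (hab _ ht).2
          · exact (hc t' h).2.2 _ ht h')
      simp only [Finset.mem_insert, Finset.mem_image, Finset.mem_filter,
        Finset.mem_singleton] at h1 h2
      exact ⟨d, fun _ => ⟨h1 t rfl, h2 _ (Or.inl rfl),
        fun t' h h' => h2 _ (Or.inr ⟨t', ⟨h, h'⟩, rfl⟩)⟩⟩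
    · exact ⟨t, fun h => absurd h ht⟩
  choose d hd using hd
  exact ⟨c, d, fun t ht => ⟨(hc t ht).1, (hc t ht).2.1, (hd t ht).1, (hd t ht).2.1⟩,
    fun t ht => (hd t ht).2.2⟩

/-- If two finite families of points are in the same order and correspond to each other up to the
covering `{Iio t, Ioi c}` and the covering `{Iio d, Ioi t}`, where `c < t < d`, then there is a
point in `Ioo c d` whose position in the second family is that of `t` in the first one. -/
theorem exists_matching_point [DenselyOrdered X] [NoMinOrder X] [NoMaxOrder X]
    (s : Finset X) {p q : X → X} (hpq : ∀ x ∈ s, ∀ y ∈ s, p x < p y ↔ q x < q y) {c t d : X}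
    (hct : c < t) (htd : t < d) (h1 : ∀ x ∈ s, (p x, q x) ∈ orderEntourage c t)
    (h2 : ∀ x ∈ s, (p x, q x) ∈ orderEntourage t d) :
    ∃ r, c < r ∧ r < d ∧ ∀ x ∈ s, (p x < t ↔ q x < r) ∧ (t < p x ↔ r < q x) := by
  classical
  have _ : Nonempty X := ⟨t⟩
  have hc : ∀ x ∈ s, t ≤ p x → c < q x := fun x hx h =>
    (h1 x hx).elim (fun h' => absurd h'.1 h.not_gt) And.right
  have hd : ∀ x ∈ s, p x ≤ t → q x < d := fun x hx h =>
    (h2 x hx).elim And.right (fun h' => absurd h'.1 h.not_gt)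
  by_cases ht : ∃ x ∈ s, p x = t
  · obtain ⟨x, hx, rfl⟩ := ht
    exact ⟨q x, hc x hx le_rfl, hd x hx le_rfl, fun y hy => ⟨hpq y hy x hx, hpq x hx y hy⟩⟩
  · obtain ⟨r, hr1, hr2⟩ := Order.exists_between_finsets
      (insert c ((s.filter (p · < t)).image q)) (insert d ((s.filter (t < p ·)).image q)) (by
        simp only [Finset.mem_insert, Finset.mem_image, Finset.mem_filter]
        rintro _ (rfl | ⟨x, ⟨hx, hx'⟩, rfl⟩) _ (rfl | ⟨y, ⟨hy, hy'⟩, rfl⟩)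
        · exact hct.trans htd
        · exact hc y hy hy'.le
        · exact hd x hx hx'.le
        · exact (hpq x hx y hy).1 (hx'.trans hy'))
    simp only [Finset.mem_insert, Finset.mem_image, Finset.mem_filter] at hr1 hr2
    refine ⟨r, hr1 c (Or.inl rfl), hr2 d (Or.inl rfl), fun x hx => ?_⟩
    have hlt : p x < t → q x < r := fun h => hr1 _ (Or.inr ⟨x, ⟨hx, h⟩, rfl⟩)
    have hgt : t < p x → r < q x := fun h => hr2 _ (Or.inr ⟨x, ⟨hx, h⟩, rfl⟩)
    have hne : p x ≠ t := fun h => ht ⟨x, hx, h⟩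
    grind

/-- A neighbourhood of the unit controls finitely many points `t`. An automorphism which takes
`g x` to `h x`, for all `x` in a finite set, can be prescribed at the points `t` as well, by the
position of `t` with respect to the points `g x`; this moves `t` little if `g x` and `h x` are
close to each other. -/
theorem AutPt.transportsTuples [Nontrivial X] (hX : IsUltrahomogeneous X) :
    TransportsTuples (AutPt X) (orderUniformity X) := by
  have _ := hX.noMinOrder
  have _ := hX.noMaxOrder
  have _ := hX.denselyOrdered
  intro O hO
  obtain ⟨T, a, b, hab, hTO⟩ := AutPt.exists_subset_of_mem_nhds_one hO
  obtain ⟨c, d, hcd, hsep⟩ := exists_separated_intervals T a b hab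
  refine ⟨⋂ t ∈ T, orderEntourage (c t) t ∩ orderEntourage t (d t),
    (biInter_finset_mem T).2 fun t ht => inter_mem (orderEntourage_mem (hcd t ht).2.1)
      (orderEntourage_mem (hcd t ht).2.2.1), fun s g h hgh => ?_⟩
  simp only [mem_iInter, mem_inter_iff] at hgh
  have hr : ∀ t : T, ∃ r, c t < r ∧ r < d t ∧
      ∀ x ∈ s, (g • x < t.1 ↔ h • x < r) ∧ (t.1 < g • x ↔ r < h • x) := fun t =>
    exists_matching_point s
      (fun x _ y _ => by rw [AutPt.smul_lt_smul_iff, AutPt.smul_lt_smul_iff])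
      (hcd t t.2).2.1 (hcd t t.2).2.2.1 (fun x hx => (hgh x hx t t.2).1)
      (fun x hx => (hgh x hx t t.2).2)
  choose r hcr hrd hr using hr
  have hrr : ∀ t t' : T, t.1 < t'.1 → r t < r t' := fun t t' htt' =>
    (hrd t).trans ((hsep t t.2 t' t'.2 htt').trans (hcr t'))
  obtain ⟨o, ho⟩ := hX.exists_orderIso (ι := s ⊕ T)
    (Sum.elim (fun x => g • x.1) (fun t => t.1)) (Sum.elim (fun x => h • x.1) r) (by
      rintro (x | t) (y | t')
      · simp only [Sum.elim_inl]
        rw [AutPt.smul_lt_smul_iff, AutPt.smul_lt_smul_iff]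
      · exact (hr t' x x.2).1
      · exact (hr t y y.2).2
      · refine ⟨hrr t t', fun hlt => not_le.1 fun hle => ?_⟩
        rcases hle.lt_or_eq with hl | he
        · exact (hrr t' t hl).not_gt hlt
        · exact hlt.ne (congrArg r (Subtype.ext he.symm)))
  refine ⟨o, hTO fun t ht => ?_, fun x hx => ?_⟩
  · have hot : (show AutPt X from o) • t = r ⟨t, ht⟩ := ho (Sum.inr ⟨t, ht⟩)
    rw [hot]
    exact ⟨(hcd t ht).1.trans (hcr ⟨t, ht⟩), (hrd ⟨t, ht⟩).trans (hcd t ht).2.2.2⟩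
  · exact ho (Sum.inl ⟨x, hx⟩)

/-! ### The permutation topology -/

variable (X) in
/-- The uniformity of a discrete chain which is induced by the order of `X ⊗ {-1, 0, 1}`. -/
@[reducible] def discreteOrderUniformity : UniformSpace X :=
  UniformSpace.comap (fun x => (toLex (x, 0) : Tripled X)) (orderUniformity (Tripled X))

/-- The entourage of the partition `{Iio f, {f}, Ioi f}`. -/
def cutEntourage (f : X) : Set (X × X) := {p | (p.1 < f ↔ p.2 < f) ∧ (f < p.1 ↔ f < p.2)}

theorem cutEntourage_mem (f : X) : cutEntourage f ∈ 𝓤[discreteOrderUniformity X] := by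
  have h1 : (toLex (f, -1) : Tripled X) < toLex (f, 0) :=
    Prod.Lex.toLex_lt_toLex.2 (Or.inr ⟨rfl, (by decide : (-1 : SignType) < 0)⟩)
  have h2 : (toLex (f, 0) : Tripled X) < toLex (f, 1) :=
    Prod.Lex.toLex_lt_toLex.2 (Or.inr ⟨rfl, (by decide : (0 : SignType) < 1)⟩)
  refine mem_of_superset (preimage_mem_comap (inter_mem (orderEntourage_mem h1)
    (orderEntourage_mem h2))) ?_
  rintro ⟨x, y⟩ ⟨h3, h4⟩
  simp only [orderEntourage, mem_ofPred_eq, Prod.Lex.toLex_lt_toLex, lt_irrefl, and_false, or_false,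
    show (0 : SignType) < 1 by decide, show (-1 : SignType) < 0 by decide, and_true,
    ← le_iff_lt_or_eq] at h3 h4
  simp only [cutEntourage, mem_ofPred_eq]
  grind

/-- With respect to the partitions `{Iio f, {f}, Ioi f}`, even the maps `x ↦ (x, i)` into
`X ⊗ {-1, 0, 1}` are uniformly continuous. -/
theorem tendsto_toLex_orderUniformity {ι : Type*} {l : Filter ι} {p : ι → X × X}
    (h : ∀ f, ∀ᶠ j in l, p j ∈ cutEntourage f) (i : SignType) :
    Tendsto (fun j => ((toLex ((p j).1, i) : Tripled X), (toLex ((p j).2, i) : Tripled X))) l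
      (𝓤[orderUniformity (Tripled X)]) := by
  refine tendsto_orderUniformity fun a b hab => ?_
  filter_upwards [h (ofLex a).1] with j hj
  obtain ⟨a, k⟩ := a
  generalize p j = q at hj ⊢
  obtain ⟨x, y⟩ := q
  have key : (toLex (x, i) : Tripled X) ≤ toLex (a, k) ↔
      (toLex (y, i) : Tripled X) ≤ toLex (a, k) := by
    simp only [cutEntourage, mem_ofPred_eq] at hj
    have hj1 : x < a ↔ y < a := hj.1
    have hj2 : a < x ↔ a < y := hj.2
    rw [Prod.Lex.toLex_le_toLex, Prod.Lex.toLex_le_toLex]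
    have : x = a ↔ y = a := by grind
    simp only [hj1, this]
  by_cases hx : (toLex (x, i) : Tripled X) ≤ toLex (a, k)
  · exact Or.inl ⟨hx.trans_lt hab, (key.1 hx).trans_lt hab⟩
  · exact Or.inr ⟨not_le.1 hx, not_le.1 (mt key.2 hx)⟩

theorem tendsto_discreteOrderUniformity {ι : Type*} {l : Filter ι} {p : ι → X × X}
    (h : ∀ f, ∀ᶠ j in l, p j ∈ cutEntourage f) : Tendsto p l (𝓤[discreteOrderUniformity X]) := by
  rw [uniformity_comap, tendsto_comap_iff]
  exact tendsto_toLex_orderUniformity h 0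

theorem AutPerm.smul_lt_smul_iff (g : AutPerm X) {x y : X} : g • x < g • y ↔ x < y :=
  OrderIso.lt_iff_lt (g : X ≃o X)

theorem AutPerm.fixingSubgroup_mem_nhds_one (s : Finset X) :
    (fixingSubgroup (AutPerm X) (s : Set X) : Set (AutPerm X)) ∈ 𝓝 1 := by
  have h : ∀ᶠ g : AutPerm X in 𝓝 1, ∀ x ∈ s, g • x = x :=
    (s.eventually_all).2 fun x _ => by simpa using AutPerm.eventually_smul_eq 1 x
  filter_upwards [h] with g hg
  exact (mem_fixingSubgroup_iff _).2 fun x hx => hg x (by exact_mod_cast hx)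

theorem AutPerm.exists_fixingSubgroup_subset {O : Set (AutPerm X)} (hO : O ∈ 𝓝 1) :
    ∃ s : Finset X, (fixingSubgroup (AutPerm X) (s : Set X) : Set (AutPerm X)) ⊆ O := by
  let _ : TopologicalSpace X := ⊥
  rw [nhds_induced, mem_comap] at hO
  obtain ⟨N, hN, hNO⟩ := hO
  rw [nhds_pi, Filter.mem_pi] at hN
  obtain ⟨T, hT, U, hU, hUN⟩ := hN
  refine ⟨hT.toFinset, fun o ho => hNO (hUN fun t ht => ?_)⟩
  have hot : o • t = t := (mem_fixingSubgroup_iff _).1 ho t (by simpa using ht)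
  have := mem_of_mem_nhds (hU t)
  simpa [hot] using this

theorem AutPerm.tendsto_smul_discreteOrderUniformity :
    Tendsto (fun p : AutPerm X × X × X => (p.2.1, p.1 • p.2.2))
      (𝓝 1 ×ˢ 𝓤[discreteOrderUniformity X]) (𝓤[discreteOrderUniformity X]) := by
  refine tendsto_discreteOrderUniformity fun f => ?_
  have h1 : ∀ᶠ g : AutPerm X in 𝓝 1, g • f = f := by
    simpa using AutPerm.eventually_smul_eq 1 f
  have h2 := eventually_of_mem (cutEntourage_mem f) fun _ h => h
  filter_upwards [h1.prod_mk h2] with p hp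
  obtain ⟨g, x, z⟩ := p
  obtain ⟨hg, h⟩ := hp
  have e1 : g • z < f ↔ z < f := by
    conv_lhs => rw [← show g • f = f from hg]
    exact AutPerm.smul_lt_smul_iff g
  have e2 : f < g • z ↔ f < z := by
    conv_lhs => rw [← show g • f = f from hg]
    exact AutPerm.smul_lt_smul_iff g
  exact ⟨h.1.trans e1.symm, h.2.trans e2.symm⟩

theorem AutPerm.uniformContinuous_smul (g : AutPerm X) :
    UniformContinuous[discreteOrderUniformity X, discreteOrderUniformity X] fun x => g • x := by
  refine tendsto_discreteOrderUniformity fun f => ?_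
  filter_upwards [cutEntourage_mem (g⁻¹ • f)] with p hp
  have h1 : ∀ x : X, g • x < f ↔ x < g⁻¹ • f := fun x => by
    rw [← AutPerm.smul_lt_smul_iff g (y := g⁻¹ • f), smul_inv_smul]
  have h2 : ∀ x : X, f < g • x ↔ g⁻¹ • f < x := fun x => by
    rw [← AutPerm.smul_lt_smul_iff g (x := g⁻¹ • f), smul_inv_smul]
  exact ⟨by simpa only [h1] using hp.1, by simpa only [h2] using hp.2⟩

theorem toTopologicalSpace_discreteOrderUniformity :
    (discreteOrderUniformity X).toTopologicalSpace = ⊥ := by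
  let _ := discreteOrderUniformity X
  refine eq_bot_of_singletons_open fun x => isOpen_iff_mem_nhds.2 ?_
  rintro y rfl
  refine mem_of_superset (mem_nhds_left y (cutEntourage_mem y)) fun z hz => ?_
  exact le_antisymm (not_lt.1 fun h => (lt_irrefl _ (hz.2.2 h)))
    (not_lt.1 fun h => (lt_irrefl _ (hz.1.2 h)))

theorem AutPerm.isEquiuniformity :
    IsEquiuniformity (AutPerm X) ⊥ (discreteOrderUniformity X) :=
  .of_tendsto toTopologicalSpace_discreteOrderUniformity AutPerm.uniformContinuous_smul
    AutPerm.tendsto_smul_discreteOrderUniformity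

/-- If `g x` and `h x` lie in the same class of the partition given by finitely many points `t`,
for all `x` in a finite set, then some automorphism takes `g x` to `h x` and fixes the
points `t`. -/
theorem AutPerm.transportsTuples (hX : IsUltrahomogeneous X) :
    TransportsTuples (AutPerm X) (discreteOrderUniformity X) := by
  intro O hO
  obtain ⟨T, hT⟩ := AutPerm.exists_fixingSubgroup_subset hO
  refine ⟨⋂ t ∈ T, cutEntourage t, (biInter_finset_mem T).2 fun t _ => cutEntourage_mem t,
    fun s g h hgh => ?_⟩
  simp only [mem_iInter] at hgh
  obtain ⟨o, ho⟩ := hX.exists_orderIso (ι := s ⊕ T)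
    (Sum.elim (fun x => g • x.1) (fun t => t.1)) (Sum.elim (fun x => h • x.1) (fun t => t.1)) (by
      rintro (x | t) (y | t')
      · simp only [Sum.elim_inl]
        rw [AutPerm.smul_lt_smul_iff, AutPerm.smul_lt_smul_iff]
      · exact (hgh x x.2 t' t'.2).1
      · exact (hgh y y.2 t t.2).2
      · exact Iff.rfl)
  refine ⟨o, hT ((mem_fixingSubgroup_iff _).2 fun t ht => ?_), fun x hx => ?_⟩
  · exact ho (Sum.inr ⟨t, ht⟩)
  · exact ho (Sum.inl ⟨x, hx⟩)

/-! ### The chain `X ⊗ {-1, 0, 1}` -/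

theorem SignType.nonneg_of_neg_one_lt {i : SignType} (h : -1 < i) : 0 ≤ i := by
  revert h; revert i; decide

theorem SignType.eq_one_of_pos {i : SignType} (h : 0 < i) : i = 1 := by
  revert h; revert i; decide

theorem denseRange_toLex_zero [DenselyOrdered X] [NoMinOrder X] [NoMaxOrder X] :
    let _ := orderUniformity (Tripled X)
    DenseRange fun x => (toLex (x, 0) : Tripled X) := by
  intro _ z
  have _ : OrderTopology (Tripled X) := ⟨rfl⟩
  obtain ⟨x, i⟩ := z
  change (toLex (x, i) : Tripled X) ∈ _
  obtain hi | rfl | hi := lt_trichotomy i 0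
  · obtain rfl : i = -1 := by revert hi; revert i; decide
    have hlub : IsLUB ((fun y => (toLex (y, 0) : Tripled X)) '' Iio x) (toLex (x, -1)) := by
      refine ⟨?_, fun c hc => ?_⟩
      · rintro _ ⟨y, hy, rfl⟩
        exact Prod.Lex.toLex_le_toLex.2 (Or.inl hy)
      · obtain ⟨c, k⟩ := c
        refine Prod.Lex.toLex_le_toLex.2 ?_
        rcases lt_or_ge c x with hcx | hcx
        · obtain ⟨w, hcw, hwx⟩ := exists_between hcx
          have h : (toLex (w, 0) : Tripled X) ≤ toLex (c, k) := hc ⟨w, hwx, rfl⟩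
          rcases Prod.Lex.toLex_le_toLex.1 h with h | h
          · exact absurd h hcw.not_gt
          · exact absurd h.1 hcw.ne'
        · exact hcx.lt_or_eq.imp id fun h => ⟨h, SignType.neg_one_le k⟩
    exact closure_mono (image_subset_range _ _)
      (hlub.mem_closure ((exists_lt x).elim fun y hy => ⟨_, y, hy, rfl⟩))
  · exact subset_closure ⟨x, rfl⟩
  · obtain rfl : i = 1 := by revert hi; revert i; decide
    have hglb : IsGLB ((fun y => (toLex (y, 0) : Tripled X)) '' Ioi x) (toLex (x, 1)) := by
      refine ⟨?_, fun c hc => ?_⟩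
      · rintro _ ⟨y, hy, rfl⟩
        exact Prod.Lex.toLex_le_toLex.2 (Or.inl hy)
      · obtain ⟨c, k⟩ := c
        refine Prod.Lex.toLex_le_toLex.2 ?_
        rcases lt_or_ge x c with hcx | hcx
        · obtain ⟨w, hxw, hwc⟩ := exists_between hcx
          have h : (toLex (c, k) : Tripled X) ≤ toLex (w, 0) := hc ⟨w, hxw, rfl⟩
          rcases Prod.Lex.toLex_le_toLex.1 h with h | h
          · exact absurd h hwc.not_gt
          · exact absurd h.1 hwc.ne'
        · exact hcx.lt_or_eq.imp id fun h => ⟨h, SignType.le_one k⟩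
    exact closure_mono (image_subset_range _ _)
      (hglb.mem_closure ((exists_gt x).elim fun y hy => ⟨_, y, hy, rfl⟩))

theorem IsContinuousChain.tripled [DenselyOrdered X] [NoMinOrder X] [NoMaxOrder X]
    (hX : IsContinuousChain X) : IsContinuousChain (Tripled X) := by
  intro A hA hne hne'
  have hle : ∀ {x y : X} {i k : SignType}, x < y → (toLex (x, i) : Tripled X) ≤ toLex (y, k) :=
    fun h => Prod.Lex.toLex_le_toLex.2 (Or.inl h)
  have hle' : ∀ {x : X} {i k : SignType}, i ≤ k → (toLex (x, i) : Tripled X) ≤ toLex (x, k) :=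
    fun h => Prod.Lex.toLex_le_toLex.2 (Or.inr ⟨rfl, h⟩)
  let B : Set X := {x | (toLex (x, 0) : Tripled X) ∈ A}
  have hB : IsLowerSet B := fun x y hyx hx =>
    hA (hyx.lt_or_eq.elim hle fun h => by rw [h]) hx
  have hBne : B.Nonempty := by
    obtain ⟨⟨x, i⟩, hx⟩ := hne
    exact (exists_lt x).imp fun y hy => hA (hle hy) hx
  have hBne' : Bᶜ.Nonempty := by
    obtain ⟨⟨x, i⟩, hx⟩ := hne'
    exact (exists_gt x).imp fun y hy h => hx (hA (hle hy) h)
  rcases hX B hB hBne hBne' with ⟨a, ha, hmax⟩ | ⟨b, hb, hmin⟩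
  · left
    have hfst : ∀ {x : X} {i : SignType}, (toLex (x, i) : Tripled X) ∈ A → x ≤ a := by
      intro x i hx
      refine not_lt.1 fun h => ?_
      obtain ⟨w, haw, hwx⟩ := exists_between h
      exact haw.not_ge (hmax (hA (hle hwx) hx))
    by_cases h1 : (toLex (a, 1) : Tripled X) ∈ A
    · refine ⟨_, h1, ?_⟩
      rintro ⟨x, i⟩ hx
      rcases (hfst hx).lt_or_eq with h | rfl
      · exact hle h
      · exact hle' (SignType.le_one i)
    · refine ⟨_, ha, ?_⟩
      rintro ⟨x, i⟩ hx
      rcases (hfst hx).lt_or_eq with h | rfl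
      · exact hle h
      · refine hle' (not_lt.1 fun hi => h1 ?_)
        rwa [← SignType.eq_one_of_pos hi]
  · have hfst : ∀ {x : X} {i : SignType}, (toLex (x, i) : Tripled X) ∉ A → b ≤ x := by
      intro x i hx
      refine not_lt.1 fun h => ?_
      obtain ⟨w, hxw, hwb⟩ := exists_between h
      exact hx (hA (hle hxw) (not_not.1 fun hw => hwb.not_ge (hmin hw)))
    by_cases h1 : (toLex (b, -1) : Tripled X) ∈ A
    · left
      refine ⟨_, h1, ?_⟩
      rintro ⟨x, i⟩ hx
      refine not_lt.1 fun hlt => ?_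
      refine hb (hA ?_ hx)
      rcases Prod.Lex.toLex_lt_toLex.1 hlt with h | ⟨h, hi⟩
      · exact hle h
      · obtain rfl : b = x := h
        exact hle' (SignType.nonneg_of_neg_one_lt hi)
    · right
      refine ⟨_, h1, ?_⟩
      rintro ⟨x, i⟩ hx
      rcases (hfst hx).lt_or_eq with h | rfl
      · exact hle h
      · exact hle' (SignType.neg_one_le i)

end Chain

/-! ### The maximal equivariant compactifications -/

/-- An identification of the completion of a `G`-space with the cuts of a chain `L` is equivariant
if the embedding of the space into `L` is. -/
theorem apply_extMap_eq_cutMap {G X L : Type*} [Group G] [MulAction G X] [LinearOrder L]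
    {u : UniformSpace X} (hu : ∀ g : G, UniformContinuous[u, u] fun x => g • x)
    {φ : UComp u → DedekindCut L} (hφ : Continuous φ) {i : X → L}
    (hi : ∀ x, φ (UComp.of u x) = DedekindCut.principal (i x)) {g : G} {f : L ≃o L}
    (hf : ∀ x, f (i x) = i (g • x)) (z : UComp u) : φ (extMap u g z) = cutMap f (φ z) := by
  refine congrFun ((UComp.denseRange_of u).equalizer (hφ.comp (continuous_extMap g))
    ((continuous_cutMap f).comp hφ) (funext fun x => ?_)) z
  simp only [Function.comp_apply, extMap_of hu, hi, cutMap_principal, hf]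

/-- If the chain `L` has no proper gaps, then the uniform continuity of the orbit maps of all
points of `m L` need only be checked at the points of `L`. -/
theorem uniformContinuous_extMap_of_continuousChain {G X L : Type*} [Group G] [MulAction G X]
    [LinearOrder L] (hL : IsContinuousChain L) {u : UniformSpace X} {v : UniformSpace G}
    (φ : UComp u ≃ᵤ DedekindCut L) (f : G → L ≃o L)
    (hφ : ∀ (g : G) z, φ (extMap u g z) = cutMap (f g) (φ z))
    (h : ∀ a : L, UniformContinuous[v, orderUniformity L] fun g => f g a) (z : UComp u) :
    UniformContinuous[v, inferInstance] fun g : G => extMap u g z := by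
  have hφ' : (fun g : G => extMap u g z) = φ.symm ∘ fun g => cutMap (f g) (φ z) := by
    funext g
    simp [← hφ]
  rw [hφ']
  refine φ.symm.uniformContinuous.comp ?_
  rcases hL.eq_bot_or_eq_top_or_principal (φ z) with hz | hz | ⟨a, hz⟩
  · simp only [hz, cutMap_bot]
    exact uniformContinuous_const
  · simp only [hz, cutMap_top]
    exact uniformContinuous_const
  · simp only [hz, cutMap_principal]
    have hp : UniformContinuous[orderUniformity L, inferInstance]
        (DedekindCut.principal : L → DedekindCut L) :=
      uniformContinuous_iff_le_comap.2 (orderUniformity_eq_comap_principal L).le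
    exact @UniformContinuous.comp _ _ _ v (orderUniformity L) _ _ _ hp (h a)

section Compactifications
variable {X : Type*} [LinearOrder X]

theorem AutPt.isPretransitive (hX : IsUltrahomogeneous X) :
    MulAction.IsPretransitive (AutPt X) X := ⟨hX.exists_apply_eq⟩

theorem AutPerm.isPretransitive (hX : IsUltrahomogeneous X) :
    MulAction.IsPretransitive (AutPerm X) X := ⟨hX.exists_apply_eq⟩

theorem ptU_eq [Nontrivial X] (hX : IsUltrahomogeneous X) : ptU X = orderUniformity X := by
  have _ := hX.denselyOrdered
  have _ := AutPt.isPretransitive hX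
  exact ((AutPt.transportsTuples hX).isLeast AutPt.isEquiuniformity).isGLB.sInf_eq

theorem permU_eq (hX : IsUltrahomogeneous X) : permU X = discreteOrderUniformity X := by
  have _ := AutPerm.isPretransitive hX
  exact ((AutPerm.transportsTuples hX).isLeast AutPerm.isEquiuniformity).isGLB.sInf_eq

theorem discreteOrderUniformity_eq_comap : discreteOrderUniformity X =
    UniformSpace.comap (fun x => DedekindCut.principal (toLex (x, 0) : Tripled X))
      inferInstance := by
  rw [discreteOrderUniformity, orderUniformity_eq_comap_principal, ← UniformSpace.comap_comap]
  rfl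

theorem denseRange_principal_toLex_zero [DenselyOrdered X] [NoMinOrder X] [NoMaxOrder X]
    [Nonempty X] : DenseRange fun x => DedekindCut.principal (toLex (x, 0) : Tripled X) := by
  let _ := orderUniformity (Tripled X)
  have _ : Nonempty (Tripled X) := ‹Nonempty X›.map fun x => toLex (x, 0)
  have hc : UniformContinuous (DedekindCut.principal : Tripled X → DedekindCut (Tripled X)) :=
    uniformContinuous_iff_le_comap.2 (orderUniformity_eq_comap_principal _).le
  exact (DedekindCut.denseRange_principal (Tripled X)).comp denseRange_toLex_zero hc.continuous

theorem exists_uniformEquiv_orderUniformity [Nonempty X] :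
    ∃ φ : UComp (orderUniformity X) ≃ᵤ DedekindCut X,
      (∀ x, φ (UComp.of _ x) = DedekindCut.principal x) ∧
      ∀ (g : AutPt X) z, φ (extMap _ g z) = cutMap (g : X ≃o X) (φ z) := by
  obtain ⟨φ, hφ⟩ := exists_uniformEquiv_of_denseRange (orderUniformity_eq_comap_principal X)
    (DedekindCut.denseRange_principal X)
  exact ⟨φ, hφ, fun g z => apply_extMap_eq_cutMap AutPt.uniformContinuous_smul φ.continuous hφ
    (i := id) (f := (g : X ≃o X)) (fun _ => rfl) z⟩

theorem exists_uniformEquiv_discreteOrderUniformity [DenselyOrdered X] [NoMinOrder X]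
    [NoMaxOrder X] [Nonempty X] :
    ∃ φ : UComp (discreteOrderUniformity X) ≃ᵤ DedekindCut (Tripled X),
      (∀ x, φ (UComp.of _ x) = DedekindCut.principal (toLex (x, 0))) ∧
      ∀ (g : AutPerm X) z, φ (extMap _ g z) = cutMap (tripledMap (g : X ≃o X)) (φ z) := by
  obtain ⟨φ, hφ⟩ := exists_uniformEquiv_of_denseRange
    (discreteOrderUniformity_eq_comap (X := X)) denseRange_principal_toLex_zero
  exact ⟨φ, hφ, fun g z => apply_extMap_eq_cutMap AutPerm.uniformContinuous_smul φ.continuous hφ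
    (f := tripledMap (g : X ≃o X)) (fun _ => rfl) z⟩

theorem ellisUniformity_eq_comap_extMap_pt [Nonempty X] (hc : IsContinuousChain X) :
    ellisUniformity (AutPt X) (orderUniformity X) =
      UniformSpace.comap (extMap (G := AutPt X) (orderUniformity X)) inferInstance := by
  obtain ⟨φ, -, hφ⟩ := exists_uniformEquiv_orderUniformity (X := X)
  exact ellisUniformity_eq_comap_extMap AutPt.uniformContinuous_smul
    (uniformContinuous_extMap_of_continuousChain hc φ (fun g : AutPt X => (g : X ≃o X)) hφ
      fun a => uniformContinuous_smul_ellisUniformity _ a)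

theorem ellisUniformity_eq_comap_extMap_perm [DenselyOrdered X] [NoMinOrder X] [NoMaxOrder X]
    [Nonempty X] (hc : IsContinuousChain X) :
    ellisUniformity (AutPerm X) (discreteOrderUniformity X) =
      UniformSpace.comap (extMap (G := AutPerm X) (discreteOrderUniformity X)) inferInstance := by
  obtain ⟨φ, -, hφ⟩ := exists_uniformEquiv_discreteOrderUniformity (X := X)
  refine ellisUniformity_eq_comap_extMap AutPerm.uniformContinuous_smul
    (uniformContinuous_extMap_of_continuousChain hc.tripled φ
      (fun g : AutPerm X => tripledMap (g : X ≃o X)) hφ ?_)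
  rintro ⟨a, i⟩
  exact tendsto_toLex_orderUniformity (fun f =>
    uniformContinuous_smul_ellisUniformity (G := AutPerm X) _ a (cutEntourage_mem f)) i

end Compactifications

theorem mainTheorem8 (X : Type*) [LinearOrder X] [Nontrivial X] (hX : IsUltrahomogeneous X) :
    -- the maximal equivariant compactifications of `X`
    (IsMaxTotallyBounded (AutPerm X) ⊥ (permU X) ∧ PermBetaEqCuts X) ∧
    (IsMaxTotallyBounded (AutPt X) (Preorder.topology X) (ptU X) ∧ PtBetaEqCuts X) ∧
    -- the permutation topology
    (roelckeUniformity (AutPerm X) = ellisUniformity (AutPerm X) (permU X) ∧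
      CompactSpace (UComp (roelckeUniformity (AutPerm X))) ∧
      IsCompletionVia (roelckeUniformity (AutPerm X)) (orbitMap (permU X))
        (closure (range (orbitMap (G := AutPerm X) (permU X))))) ∧
    -- the topology of pointwise convergence
    (stabUniformity (AutPt X) X = ellisUniformity (AutPt X) (ptU X) ∧
      CompactSpace (UComp (stabUniformity (AutPt X) X)) ∧
      IsCompletionVia (stabUniformity (AutPt X) X) (orbitMap (ptU X))
        (closure (range (orbitMap (G := AutPt X) (ptU X))))) ∧
    -- continuous chains
    (IsContinuousChain X →
      IsCompletionVia (roelckeUniformity (AutPerm X)) (extMap (permU X))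
        (envelopingSemigroup (AutPerm X) (permU X)) ∧
      IsCompletionVia (stabUniformity (AutPt X) X) (extMap (ptU X))
        (envelopingSemigroup (AutPt X) (ptU X))) := by
  have _ := hX.noMinOrder
  have _ := hX.noMaxOrder
  have _ := hX.denselyOrdered
  have _ := AutPerm.isPretransitive hX
  have _ := AutPt.isPretransitive hX
  have htd := AutPerm.transportsTuples hX
  have htp := AutPt.transportsTuples hX
  obtain ⟨φd, hφd, hφd'⟩ := exists_uniformEquiv_discreteOrderUniformity (X := X)
  obtain ⟨φp, hφp, hφp'⟩ := exists_uniformEquiv_orderUniformity (X := X)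
  have hR : roelckeUniformity (AutPerm X) =
      ellisUniformity (AutPerm X) (discreteOrderUniformity X) :=
    htd.roelckeUniformity_eq AutPerm.isEquiuniformity AutPerm.fixingSubgroup_mem_nhds_one
      fun _ => AutPerm.exists_fixingSubgroup_subset
  have hS : stabUniformity (AutPt X) X = ellisUniformity (AutPt X) (orderUniformity X) :=
    htp.stabUniformity_eq AutPt.isEquiuniformity
  have hRc := isCompletionVia_closure_range (hR.trans (ellisUniformity_eq_comap_orbitMap _))
  have hSc := isCompletionVia_closure_range (hS.trans (ellisUniformity_eq_comap_orbitMap _))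
  have _ : CompactSpace (UComp (discreteOrderUniformity X)) :=
    φd.symm.toHomeomorph.compactSpace
  have _ : CompactSpace (UComp (orderUniformity X)) := φp.symm.toHomeomorph.compactSpace
  rw [PermBetaEqCuts, PtBetaEqCuts, permU_eq hX, ptU_eq hX]
  refine ⟨⟨⟨htd.isLeast AutPerm.isEquiuniformity,
      totallyBounded_univ_of_eq_comap discreteOrderUniformity_eq_comap,
      AutPerm.isEquiuniformity.continuous_extMap⟩, φd.toHomeomorph, hφd, hφd'⟩,
    ⟨⟨htp.isLeast AutPt.isEquiuniformity,
      totallyBounded_univ_of_eq_comap (orderUniformity_eq_comap_principal X),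
      AutPt.isEquiuniformity.continuous_extMap⟩, φp.toHomeomorph, hφp, hφp'⟩,
    ⟨hR, hRc.compactSpace isClosed_closure, hRc⟩, ⟨hS, hSc.compactSpace isClosed_closure, hSc⟩,
    fun hc => ⟨?_, ?_⟩⟩
  · exact isCompletionVia_closure_range (hR.trans (ellisUniformity_eq_comap_extMap_perm hc))
  · exact isCompletionVia_closure_range (hS.trans (ellisUniformity_eq_comap_extMap_pt hc))
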